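/- **Setting.** Let $G=([n],E,w)$ be a finite simple graph with edge weights $w_{ij}>0$. The EPR Hamiltonian on $n$ qubits is $H(G)=\sum_{(i,j)\in E}w_{ij}h_{ij}$, $h_{ij}=\tfrac12(I_iI_j+X_iX_j-Y_iY_j+Z_iZ_j)$. Let $\mathcal P_2$ be the set of Pauli monomials on $n$ qubits with at most two non-identity factors. The level-2 moment matrices are the real symmetric $\Gamma\in\mathbb R^{\mathcal P_2\times\mathcal P_2}$ with $\Gamma\succeq 0$, $\Gamma(A,A)=1$, $\Gamma(A,B)=\pm\Gamma(A',B')$ whenever $AB=\pm A'B'$, and $\Gamma(A,B)=0$ whenever $AB$ is not Hermitian; write $L(AB)=\Gamma(A,B)$, extended linearly. The level-2 quantum moment-SoS relaxation maximizes $L(H(G))$ over these $\Gamma$; an optimal solution gives $g_{ij}=\tfrac12(-1+L(X_iX_j)-L(Y_iY_j)+L(Z_iZ_j))$ and $u(G)=\sum_{(i,j)\in E}w_{ij}(1+g_{ij})$. **Algorithm 1** with angle function $\nu$ computes such an optimal solution and outputs $$|\psi_G\rangle=\prod_{(i,j)\in E}\exp\!\Big(\tfrac{\mathbf i\,\nu(g_{ij})}{4}(X_i-Y_i)\otimes(X_j-Y_j)\Big)|0\rangle^{\otimes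 n}.$$ It has approximation ratio at least $a$ if, for every weighted graph $G$, an optimal solution exists and, whichever optimal solution is used, $a\,\lambda_{\max}(H(G))\le\langle\psi_G|H(G)|\psi_G\rangle\le\lambda_{\max}(H(G))$. Put $$\ell(G)=\sum_{(i,j)\in E}w_{ij}\frac{1+A_{ij}A_{ji}+(A_{ij}+A_{ji})\sin\nu(g_{ij})}{2},\quad A_{ij}=\prod_{k\in N(i)\setminus\{j\}}\cos\nu(g_{ik}),\qquad \alpha=\inf_G\frac{\ell(G)}{u(G)},$$ the infimum being over all weighted graphs with at least one edge and all optimal solutions. **Parameters.** Write $x^+=\max\{x,0\}$, $R(x)=\tfrac12(\sqrt{3(1-x^2)}-x)$, and $Q(x)=1-x$ for $0\le x\le\frac12$, $Q(x)=R(x)$ for $\frac12<x\le\frac{\sqrt3}2$, $Q(x)=0$ for $\frac{\sqrt3}2<x\le1$. Let $\mathcal C$ be the set of monotonically increasing (not necessarily strictly) $\Theta:[0,1]\to[0,1]$ with $\Theta(0)=0$ and $\prod_{i=1}^p(1-\Theta(x_i))\ge1-\Theta(\sum_{i=1}^p x_i)$ for all $x_1,\dots,x_p\in[0,1]$ with $\sum_i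 x_i\le1$. For $\Theta\in\mathcal C$, $\Lambda:[0,1]\to[0,1]$, let $$f(x,y)=\sqrt{(1-\Lambda(y^+))(1-\Theta(Q(y^+)-x^+))},\qquad f^*(x)=f(x,R(x)).$$ For $\frac12<\beta\le1$ let $\mathcal D_{\Theta,\beta}$ be the set of $\Lambda:[0,1]\to[0,1]$ such that $f(x,y)\ge f^*(x)$ whenever $-1\le x\le R(\beta)$ and $\beta\le y\le R(x)$. Define $$r_1(g)=\frac{2-\Theta(Q(g^+))+2\sqrt{\Theta(g^+)(1-\Theta(Q(g^+)))}}{2(1+g)},\quad r_2(g)=\frac{2-\Theta(Q(g^+))+2\sqrt{\Lambda(g^+)(1-\Theta(Q(g^+)))}}{2(1+g)},$$ $$r_3(g)=\frac{1+f^*(g)^2+2\sqrt{\Theta(g^+)}\,f^*(g)}{2(1+g)}.$$ **Claim.** Let $\frac12<\beta\le1$, $\Theta\in\mathcal C$, $\Lambda\in\mathcal D_{\Theta,\beta}$, and let $\nu(x)=\arcsin\sqrt{\Theta(x^+)}$ for $x\le\beta$ and $\nu(x)=\arcsin\sqrt{\Lambda(x^+)}$ for $x>\beta$. Then Algorithm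 1 with this $\nu$ has approximation ratio at least $\alpha$, and $$\alpha\ \ge\ \min\Big\{\inf_{0\le g\le\beta}r_1(g),\ \inf_{\beta\le g\le1}r_2(g),\ \inf_{-1<g\le R(\beta)}r_3(g)\Big\};$$ in particular its approximation ratio is at least the right-hand side. -/

import Mathlib

namespace EPR

noncomputable section

open Finset

/-! ### Operators on `n` qubits -/

/-- Operators on `n` qubits, as matrices in the computational basis `Fin n → Fin 2`. -/
abbrev Op (n : ℕ) : Type := Matrix (Fin n → Fin 2) (Fin n → Fin 2) ℂ

/-- The tensor product `A₁ ⊗ ⋯ ⊗ Aₙ` of one-qubit operators. -/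
def tensorOp {n : ℕ} (A : Fin n → Matrix (Fin 2) (Fin 2) ℂ) : Op n :=
  Matrix.of fun s t => ∏ k, A k (s k) (t k)

theorem tensorOp_mul {n : ℕ} (A B : Fin n → Matrix (Fin 2) (Fin 2) ℂ) :
    tensorOp A * tensorOp B = tensorOp (fun k => A k * B k) := by
  ext s t
  simp only [tensorOp, Matrix.mul_apply, Matrix.of_apply, Finset.prod_univ_sum,
    Fintype.piFinset_univ, Finset.prod_mul_distrib]

/-- Labels of the one-qubit Pauli operators. -/
inductive Pauli
  | I | X | Y | Z
  deriving DecidableEq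

instance : Fintype Pauli := ⟨{.I, .X, .Y, .Z}, fun x => by cases x <;> decide⟩

/-- The Pauli matrices. -/
def Pauli.mat : Pauli → Matrix (Fin 2) (Fin 2) ℂ
  | .I => 1
  | .X => !![0, 1; 1, 0]
  | .Y => !![0, -Complex.I; Complex.I, 0]
  | .Z => !![1, 0; 0, -1]

/-- The operator acting as `σ` on qubit `i` and trivially elsewhere: `X_i`, `Y_i`, `Z_i`. -/
def site {n : ℕ} (σ : Pauli) (i : Fin n) : Op n :=
  tensorOp (fun k => if k = i then σ.mat else 1)

theorem site_commute {n : ℕ} (σ τ : Pauli) {i j : Fin n} (h : i ≠ j) :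
    Commute (site σ i) (site τ j) := by
  unfold Commute SemiconjBy site
  rw [tensorOp_mul, tensorOp_mul]
  congr 1
  funext k
  by_cases hi : k = i
  · subst hi
    simp [h]
  · simp [hi]

/-- `X_i - Y_i`. -/
def xMinusY {n : ℕ} (i : Fin n) : Op n := site .X i - site .Y i

theorem xMinusY_commute {n : ℕ} (i j : Fin n) :
    Commute (xMinusY i) (xMinusY j) := by
  by_cases h : i = j
  · subst h
    exact Commute.refl _
  · unfold xMinusY
    exact ((site_commute _ _ h).sub_left (site_commute _ _ h)).sub_right
      ((site_commute _ _ h).sub_left (site_commute _ _ h))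

/-- The largest eigenvalue of a (Hermitian) operator. -/
def lambdaMax {n : ℕ} (A : Op n) : ℝ := sSup (spectrum ℝ A)

/-! ### Weighted graphs and the EPR Hamiltonian -/

open Classical in
/-- The edges of `G`; each undirected edge `{i, j}` is listed once, as `(i, j)` with `i < j`. -/
def edges {n : ℕ} (G : SimpleGraph (Fin n)) : Finset (Fin n × Fin n) :=
  univ.filter fun e => e.1 < e.2 ∧ G.Adj e.1 e.2

/-- The edge weights are strictly positive. -/
def PosWeight {n : ℕ} (G : SimpleGraph (Fin n)) (w : Fin n × Fin n → ℝ) : Prop :=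
  ∀ e ∈ edges G, 0 < w e

/-- `h_{ij} = (I_i I_j + X_i X_j - Y_i Y_j + Z_i Z_j) / 2`. -/
def edgeHam {n : ℕ} (i j : Fin n) : Op n :=
  (1 / 2 : ℝ) • (site .I i * site .I j + site .X i * site .X j
    - site .Y i * site .Y j + site .Z i * site .Z j)

/-- The EPR Hamiltonian `H(G) = ∑_{(i,j) ∈ E} w_{ij} h_{ij}`. -/
def eprHam {n : ℕ} (G : SimpleGraph (Fin n)) (w : Fin n × Fin n → ℝ) : Op n :=
  ∑ e ∈ edges G, w e • edgeHam e.1 e.2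

/-! ### The quantum moment-SoS hierarchy -/

/-- `𝒫_k`: the Pauli monomials on `n` qubits with at most `k` non-identity factors. -/
abbrev PauliMon (n k : ℕ) : Type :=
  {p : Fin n → Pauli // (univ.filter fun i => p i ≠ Pauli.I).card ≤ k}

/-- The operator of a Pauli monomial. -/
def PauliMon.op {n k : ℕ} (A : PauliMon n k) : Op n := tensorOp fun i => (A.1 i).mat

/-- The identity, as a Pauli monomial. -/
def PauliMon.one (n k : ℕ) : PauliMon n k := ⟨fun _ => .I, by simp⟩

/-- The monomial `σ_i σ_j` (for `i ≠ j`). -/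
def PauliMon.pair {n : ℕ} (σ : Pauli) (i j : Fin n) : PauliMon n 2 :=
  ⟨fun k => if k = i ∨ k = j then σ else .I, by
    refine le_trans (Finset.card_le_card (t := {i, j}) ?_) Finset.card_le_two
    intro k hk
    by_contra hne
    simp only [mem_insert, mem_singleton] at hne
    simp [hne] at hk⟩

/-- `ℳ_k`: the real moment matrices of level `k`. -/
structure IsMoment {n k : ℕ} (Γ : Matrix (PauliMon n k) (PauliMon n k) ℝ) : Prop where
  psd : Γ.PosSemidef
  eq_of_eq : ∀ A B A' B' : PauliMon n k, A.op * B.op = A'.op * B'.op → Γ A B = Γ A' B'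
  eq_neg_of_eq_neg : ∀ A B A' B' : PauliMon n k,
    A.op * B.op = -(A'.op * B'.op) → Γ A B = -Γ A' B'
  eq_zero : ∀ A B : PauliMon n k, ¬ (A.op * B.op).IsHermitian → Γ A B = 0
  diag : ∀ A : PauliMon n k, Γ A A = 1

/-- The pseudo-expectation `L(C)` of a monomial `C = C · I`. -/
def pseudoExp {n k : ℕ} (Γ : Matrix (PauliMon n k) (PauliMon n k) ℝ) (C : PauliMon n k) : ℝ :=
  Γ C (PauliMon.one n k)

/-- The level-`2` objective `L(H(G))`, expanded by linearity of `L`. -/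
def sdpObjective {n : ℕ} (G : SimpleGraph (Fin n)) (w : Fin n × Fin n → ℝ)
    (Γ : Matrix (PauliMon n 2) (PauliMon n 2) ℝ) : ℝ :=
  ∑ e ∈ edges G, w e * ((1 / 2) * (pseudoExp Γ (.one n 2) + pseudoExp Γ (.pair .X e.1 e.2)
    - pseudoExp Γ (.pair .Y e.1 e.2) + pseudoExp Γ (.pair .Z e.1 e.2)))

/-- `Γ` is an optimal solution of the level-`2` moment-SoS program of `(G, w)`. -/
def IsSDPSolution {n : ℕ} (G : SimpleGraph (Fin n)) (w : Fin n × Fin n → ℝ)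
    (Γ : Matrix (PauliMon n 2) (PauliMon n 2) ℝ) : Prop :=
  IsMoment Γ ∧ ∀ Γ' : Matrix (PauliMon n 2) (PauliMon n 2) ℝ, IsMoment Γ' →
    sdpObjective G w Γ' ≤ sdpObjective G w Γ

/-- `g_{ij} = (-1 + L(X_i X_j) - L(Y_i Y_j) + L(Z_i Z_j)) / 2`. -/
def gval {n : ℕ} (Γ : Matrix (PauliMon n 2) (PauliMon n 2) ℝ) (i j : Fin n) : ℝ :=
  (-1 + pseudoExp Γ (.pair .X i j) - pseudoExp Γ (.pair .Y i j) + pseudoExp Γ (.pair .Z i j)) / 2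

/-- `u(G) = ∑_{(i,j) ∈ E} w_{ij} (1 + g_{ij})`. -/
def upper {n : ℕ} (G : SimpleGraph (Fin n)) (w : Fin n × Fin n → ℝ)
    (Γ : Matrix (PauliMon n 2) (PauliMon n 2) ℝ) : ℝ :=
  ∑ e ∈ edges G, w e * (1 + gval Γ e.1 e.2)

/-! ### The algorithm -/

/-- The gate `exp ((𝐢 θ / 4) (X_i - Y_i) ⊗ (X_j - Y_j))`. -/
def gate {n : ℕ} (θ : ℝ) (i j : Fin n) : Op n :=
  NormedSpace.exp ((Complex.I * (θ : ℂ) / 4) • (xMinusY i * xMinusY j))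

theorem gate_commute {n : ℕ} (θ θ' : ℝ) (i j k l : Fin n) :
    Commute (gate θ i j) (gate θ' k l) := by
  have h : Commute (xMinusY i * xMinusY j) (xMinusY k * xMinusY l) :=
    ((xMinusY_commute i k).mul_left (xMinusY_commute j k)).mul_right
      ((xMinusY_commute i l).mul_left (xMinusY_commute j l))
  exact Commute.exp ((h.smul_left _).smul_right _)

/-- The circuit `∏_{(i,j) ∈ E} exp ((𝐢 θ_{ij} / 4) (X_i - Y_i) ⊗ (X_j - Y_j))`; the gates commute. -/
def circuit {n : ℕ} (G : SimpleGraph (Fin n)) (θ : Fin n → Fin n → ℝ) : Op n :=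
  (edges G).noncommProd (fun e => gate (θ e.1 e.2) e.1 e.2)
    (fun _ _ _ _ _ => gate_commute _ _ _ _ _ _)

/-- The output state `|ψ_G⟩` of the algorithm, with angles `θ_{ij} = ν(g_{ij})`, where `g` is
computed from the solution `Γ` of the semidefinite program. -/
def outputState {n : ℕ} (ν : ℝ → ℝ) (G : SimpleGraph (Fin n))
    (Γ : Matrix (PauliMon n 2) (PauliMon n 2) ℝ) : (Fin n → Fin 2) → ℂ :=
  (circuit G fun i j => ν (gval Γ i j)).mulVec (Pi.single (fun _ => 0) 1)

/-- The energy `⟨ψ| H |ψ⟩`. -/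
def energy {n : ℕ} (H : Op n) (ψ : (Fin n → Fin 2) → ℂ) : ℝ :=
  (dotProduct (star ψ) (H.mulVec ψ)).re

/-- The algorithm run with the angle function `ν` is an `α`-approximation for the EPR problem: on
every weighted graph its first step has a solution, and for every solution that this step may
return, the energy of the output state is at least `α` times, and at most, the largest eigenvalue
of the EPR Hamiltonian. -/
def IsApproximation (ν : ℝ → ℝ) (α : ℝ) : Prop :=
  ∀ (n : ℕ) (G : SimpleGraph (Fin n)) (w : Fin n × Fin n → ℝ), PosWeight G w →
    (∃ Γ, IsSDPSolution G w Γ) ∧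
    ∀ Γ, IsSDPSolution G w Γ →
      α * lambdaMax (eprHam G w) ≤ energy (eprHam G w) (outputState ν G Γ) ∧
      energy (eprHam G w) (outputState ν G Γ) ≤ lambdaMax (eprHam G w)

open Classical in
/-- `A_{ij} = ∏_{k ∈ N(i) ∖ {j}} cos ν(g_{ik})`. -/
def Acoef {n : ℕ} (ν : ℝ → ℝ) (G : SimpleGraph (Fin n))
    (Γ : Matrix (PauliMon n 2) (PauliMon n 2) ℝ) (i j : Fin n) : ℝ :=
  ∏ k ∈ univ.filter (fun k => G.Adj i k ∧ k ≠ j), Real.cos (ν (gval Γ i k))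

/-- `ℓ(G) = ∑_{(i,j) ∈ E} w_{ij} (1 + A_{ij} A_{ji} + (A_{ij} + A_{ji}) sin ν(g_{ij})) / 2`. -/
def lower {n : ℕ} (ν : ℝ → ℝ) (G : SimpleGraph (Fin n)) (w : Fin n × Fin n → ℝ)
    (Γ : Matrix (PauliMon n 2) (PauliMon n 2) ℝ) : ℝ :=
  ∑ e ∈ edges G, w e * ((1 + Acoef ν G Γ e.1 e.2 * Acoef ν G Γ e.2 e.1
    + (Acoef ν G Γ e.1 e.2 + Acoef ν G Γ e.2 e.1) * Real.sin (ν (gval Γ e.1 e.2))) / 2)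

/-- `α = inf_G ℓ(G) / u(G)`, over all weighted graphs with at least one edge (and all solutions of
the semidefinite program). -/
def ratio (ν : ℝ → ℝ) : ℝ :=
  sInf {ρ : ℝ | ∃ (n : ℕ) (G : SimpleGraph (Fin n)) (w : Fin n × Fin n → ℝ)
    (Γ : Matrix (PauliMon n 2) (PauliMon n 2) ℝ), PosWeight G w ∧ (edges G).Nonempty ∧
      IsSDPSolution G w Γ ∧ ρ = lower ν G w Γ / upper G w Γ}

/-! ### The parameter functions -/

/-- `R(x) = (√(3 (1 - x²)) - x) / 2`. -/
def R (x : ℝ) : ℝ := (Real.sqrt (3 * (1 - x ^ 2)) - x) / 2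

/-- `Q(x)` is `1 - x` on `[0, 1/2]`, `R(x)` on `(1/2, √3/2]` and `0` on `(√3/2, 1]`. -/
def Q (x : ℝ) : ℝ :=
  if x ≤ 1 / 2 then 1 - x else if x ≤ Real.sqrt 3 / 2 then R x else 0

/-- `x⁺ = max {x, 0}`. -/
def pos (x : ℝ) : ℝ := max x 0

/-- The class `𝒞` of functions `Θ : [0,1] → [0,1]`. Only the values on `[0,1]` matter. -/
structure ThetaClass (Θ : ℝ → ℝ) : Prop where
  mapsTo : Set.MapsTo Θ (Set.Icc 0 1) (Set.Icc 0 1)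
  mono : MonotoneOn Θ (Set.Icc 0 1)
  zero : Θ 0 = 0
  prod_ge : ∀ (p : ℕ) (x : Fin p → ℝ), (∀ i, x i ∈ Set.Icc (0 : ℝ) 1) → ∑ i, x i ≤ 1 →
    1 - Θ (∑ i, x i) ≤ ∏ i, (1 - Θ (x i))

/-- `f(x, y) = √((1 - Λ(y⁺)) (1 - Θ(Q(y⁺) - x⁺)))`. -/
def f (Θ Λ : ℝ → ℝ) (x y : ℝ) : ℝ :=
  Real.sqrt ((1 - Λ (pos y)) * (1 - Θ (Q (pos y) - pos x)))

/-- `f*(x) = f(x, R(x))`. -/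
def fStar (Θ Λ : ℝ → ℝ) (x : ℝ) : ℝ := f Θ Λ x (R x)

/-- The class `𝒟_{Θ,β}` of functions `Λ : [0,1] → [0,1]`. Only the values on `[0,1]` matter. -/
structure LambdaClass (Θ : ℝ → ℝ) (β : ℝ) (Λ : ℝ → ℝ) : Prop where
  mapsTo : Set.MapsTo Λ (Set.Icc 0 1) (Set.Icc 0 1)
  fStar_le : ∀ x y : ℝ, -1 ≤ x → x ≤ R β → β ≤ y → y ≤ R x → fStar Θ Λ x ≤ f Θ Λ x y

/-- The two-piece angle function: `ν(x) = arcsin √Θ(x⁺)` for `x ≤ β` and `arcsin √Λ(x⁺)` for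
`x > β`. -/
def nu (β : ℝ) (Θ Λ : ℝ → ℝ) (x : ℝ) : ℝ :=
  Real.arcsin (Real.sqrt (if x ≤ β then Θ (pos x) else Λ (pos x)))

def r1 (Θ : ℝ → ℝ) (g : ℝ) : ℝ :=
  (2 - Θ (Q (pos g)) + 2 * Real.sqrt (Θ (pos g) * (1 - Θ (Q (pos g))))) / (2 * (1 + g))

def r2 (Θ Λ : ℝ → ℝ) (g : ℝ) : ℝ :=
  (2 - Θ (Q (pos g)) + 2 * Real.sqrt (Λ (pos g) * (1 - Θ (Q (pos g))))) / (2 * (1 + g))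

def r3 (Θ Λ : ℝ → ℝ) (g : ℝ) : ℝ :=
  (1 + fStar Θ Λ g ^ 2 + 2 * Real.sqrt (Θ (pos g)) * fStar Θ Λ g) / (2 * (1 + g))

/-- The minimum of `min_{0 ≤ g ≤ β} r₁`, `min_{β ≤ g ≤ 1} r₂` and `min_{-1 < g ≤ R(β)} r₃`, where
the inner minima are infima (nothing forces them to be attained). -/
def minBound (β : ℝ) (Θ Λ : ℝ → ℝ) : ℝ :=
  min (sInf (r1 Θ '' Set.Icc 0 β))
    (min (sInf (r2 Θ Λ '' Set.Icc β 1)) (sInf (r3 Θ Λ '' Set.Ioc (-1) (R β))))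

end

end EPR

/-!
A moment matrix is the Gram matrix of unit vectors indexed by Pauli monomials. In it, `g_{ij}` is
the inner product of the vector of the identity with a unit vector representing `h_{ij} - 1`. For
edges meeting in a vertex the inner products of the latter are prescribed up to a pseudo-expectation
of a swap, which is at most 1, so the Cauchy-Schwarz and Bessel inequalities become monogamy
inequalities: once one edge at a vertex has a large `g`, `Q` and `R` bound what is left for the
others.

The gates of the circuit commute: the `X_i - Y_i` have a common product eigenbasis, indexed by sign
patterns, and `|0…0⟩` has the same amplitude at each pattern. Correlations of the output
state are therefore averages over independent random signs; they factor over the vertices, and the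
energy of each edge is at least the corresponding summand of `ℓ(G)`. The moment matrix of a top
eigenvector of `H(G)` is feasible, so that `λ_max ≤ u(G)`, and it remains to compare `ℓ(G)` with
`u(G)` edge by edge, where the class `𝒞` merges the product of cosines around a vertex into a single
factor that the monogamy inequalities control.
-/

namespace EPR

noncomputable section

open Finset Matrix
open scoped BigOperators ComplexOrder MatrixOrder

section Spectrum

variable {𝕜 m : Type*} [RCLike 𝕜] [Fintype m] [DecidableEq m] {A : Matrix m m 𝕜}

theorem re_star_dotProduct_mulVec_le_sSup_spectrum (hA : A.IsHermitian) {x : m → 𝕜}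
    (hx : star x ⬝ᵥ x = 1) : RCLike.re (star x ⬝ᵥ A *ᵥ x) ≤ sSup (spectrum ℝ A) := by
  have hle : A ≤ algebraMap ℝ (Matrix m m 𝕜) (sSup (spectrum ℝ A)) :=
    le_algebraMap_of_spectrum_le (fun _ hy => le_csSup finite_real_spectrum.bddAbove hy)
      hA.isSelfAdjoint
  have hx' := (le_iff.mp hle).re_dotProduct_nonneg x
  rwa [sub_mulVec, dotProduct_sub, Algebra.algebraMap_eq_smul_one, smul_mulVec, one_mulVec,
    dotProduct_smul, hx, map_sub, RCLike.smul_re, RCLike.one_re, mul_one, sub_nonneg] at hx'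

theorem exists_re_star_dotProduct_mulVec_eq_sSup_spectrum [Nonempty m] (hA : A.IsHermitian) :
    ∃ x : m → 𝕜, star x ⬝ᵥ x = 1 ∧ RCLike.re (star x ⬝ᵥ A *ᵥ x) = sSup (spectrum ℝ A) := by
  have hmem : sSup (spectrum ℝ A) ∈ Set.range hA.eigenvalues := by
    rw [← hA.spectrum_real_eq_range_eigenvalues]
    refine Set.Nonempty.csSup_mem ?_ finite_real_spectrum
    exact hA.spectrum_real_eq_range_eigenvalues ▸ Set.range_nonempty _
  obtain ⟨i, hi⟩ := hmem
  refine ⟨hA.eigenvectorBasis i, ?_, hi ▸ (hA.eigenvalues_eq i).symm⟩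
  rw [dotProduct_comm, ← EuclideanSpace.inner_eq_star_dotProduct,
    inner_self_eq_norm_sq_to_K, hA.eigenvectorBasis.norm_eq_one, RCLike.ofReal_one, one_pow]

end Spectrum

section PosSemidef

variable {m : Type*}

theorem isClosed_setOf_posSemidef [Finite m] {𝕜 : Type*} [RCLike 𝕜] :
    IsClosed {A : Matrix m m 𝕜 | A.PosSemidef} := by
  have := Fintype.ofFinite m
  simp only [posSemidef_iff_dotProduct_mulVec, IsHermitian, Set.ofPred_and, Set.ofPred_forall]
  exact (isClosed_eq (by fun_prop) continuous_id).inter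
    (isClosed_iInter fun x => isClosed_le continuous_const (by fun_prop))

open scoped Matrix.Norms.L2Operator in
theorem exists_gram_eq [Fintype m] {A : Matrix m m ℝ} (hA : A.PosSemidef) :
    ∃ u : m → EuclideanSpace ℝ m, gram ℝ u = A := by
  classical
  obtain ⟨M, hM⟩ := CStarAlgebra.nonneg_iff_eq_star_mul_self.mp hA.nonneg
  refine ⟨fun i => WithLp.toLp 2 (Mᵀ i), ?_⟩
  ext i j
  rw [hM, gram_apply, EuclideanSpace.inner_eq_star_dotProduct]
  simp [dotProduct, mul_apply, mul_comm]

theorem abs_apply_le_one [Finite m] {A : Matrix m m ℝ} (hA : A.PosSemidef) (hdiag : ∀ i, A i i = 1)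
    (i j : m) : |A i j| ≤ 1 := by
  have := Fintype.ofFinite m
  obtain ⟨u, rfl⟩ := exists_gram_eq hA
  have hnorm : ∀ i, ‖u i‖ = 1 := fun i => by
    rw [norm_eq_sqrt_real_inner, ← gram_apply (𝕜 := ℝ) u, hdiag, Real.sqrt_one]
  simpa only [gram_apply, hnorm, mul_one] using abs_real_inner_le_norm (u i) (u j)

end PosSemidef

/-! ### Pauli monomials -/

theorem Pauli.mat_mul_self (σ : Pauli) : σ.mat * σ.mat = 1 := by
  cases σ <;> ext i j <;> fin_cases i <;> fin_cases j <;>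
    simp [Pauli.mat, mul_apply, Fin.sum_univ_two]

theorem Pauli.isHermitian_mat (σ : Pauli) : σ.mat.IsHermitian := by
  cases σ <;> ext i j <;> fin_cases i <;> fin_cases j <;> simp [Pauli.mat]

theorem Pauli.mat_mul_mat_eq_neg {σ τ : Pauli} (hσ : σ ≠ .I) (hτ : τ ≠ .I) (hne : σ ≠ τ) :
    σ.mat * τ.mat = -(τ.mat * σ.mat) := by
  cases σ <;> cases τ <;> simp_all [Pauli.mat]

theorem Pauli.mat_commute_or_anticommute (σ τ : Pauli) :
    σ.mat * τ.mat = τ.mat * σ.mat ∨ σ.mat * τ.mat = -(τ.mat * σ.mat) := by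
  by_cases h : σ ≠ .I ∧ τ ≠ .I ∧ σ ≠ τ
  · exact Or.inr (mat_mul_mat_eq_neg h.1 h.2.1 h.2.2)
  · left
    obtain rfl | rfl | rfl : σ = .I ∨ τ = .I ∨ σ = τ := by tauto
    all_goals simp [Pauli.mat]

theorem Pauli.mat_X_mul_Y : Pauli.X.mat * Pauli.Y.mat = Complex.I • Pauli.Z.mat := by
  simp [Pauli.mat]

theorem Pauli.mat_X_mul_Z : Pauli.X.mat * Pauli.Z.mat = (-Complex.I) • Pauli.Y.mat := by
  simp [Pauli.mat]

theorem Pauli.mat_Y_mul_Z : Pauli.Y.mat * Pauli.Z.mat = Complex.I • Pauli.X.mat := by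
  simp [Pauli.mat]

section TensorOp

variable {n : ℕ} {A B : Fin n → Matrix (Fin 2) (Fin 2) ℂ}

theorem tensorOp_smul (c : Fin n → ℂ) (A : Fin n → Matrix (Fin 2) (Fin 2) ℂ) :
    tensorOp (fun k => c k • A k) = (∏ k, c k) • tensorOp A := by
  ext s t
  simp [tensorOp, prod_mul_distrib]

theorem tensorOp_one : tensorOp (fun _ : Fin n => 1) = 1 := by
  ext s t
  simp only [tensorOp, of_apply, one_apply, prod_ite_zero, funext_iff, mem_univ, true_imp_iff,
    prod_const_one]

theorem conjTranspose_tensorOp (A : Fin n → Matrix (Fin 2) (Fin 2) ℂ) :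
    (tensorOp A)ᴴ = tensorOp fun k => (A k)ᴴ := by
  ext s t
  simp [tensorOp, conjTranspose_apply]

theorem tensorOp_eq_smul_of_forall_ne {i : Fin n} {c : ℂ} (hi : A i = c • B i)
    (hne : ∀ k, k ≠ i → A k = B k) : tensorOp A = c • tensorOp B := by
  have hA : A = fun k => (if k = i then c else 1) • B k := by
    funext k
    split_ifs with hk
    · rw [hk, hi]
    · rw [hne k hk, one_smul]
  rw [hA, tensorOp_smul, prod_ite_eq' univ i, if_pos (mem_univ i)]

theorem tensorOp_eq_or_eq_neg (h : ∀ k, A k = B k ∨ A k = -B k) :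
    tensorOp A = tensorOp B ∨ tensorOp A = -tensorOp B := by
  choose ε hε using fun k => show ∃ ε : ℤˣ, A k = ((ε : ℤ) : ℂ) • B k from
    (h k).elim (fun hk => ⟨1, by simp [hk]⟩) (fun hk => ⟨-1, by simp [hk]⟩)
  rw [funext hε, tensorOp_smul]
  have hprod : ∏ k, ((ε k : ℤ) : ℂ) = ((∏ k, ε k : ℤˣ) : ℤ) := by simp
  rw [hprod]
  rcases Int.units_eq_one_or (∏ k, ε k) with hε' | hε' <;> simp [hε']

end TensorOp

section Site

variable {n : ℕ}

theorem site_I (i : Fin n) : site .I i = 1 := by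
  simp only [site, Pauli.mat, ite_self, tensorOp_one]

theorem site_mul_site_self {σ τ ρ : Pauli} {c : ℂ} (h : σ.mat * τ.mat = c • ρ.mat)
    (i : Fin n) : site σ i * site τ i = c • site ρ i := by
  rw [site, site, tensorOp_mul]
  exact tensorOp_eq_smul_of_forall_ne (i := i) (by simpa using h) fun k hk => by simp [hk]

theorem site_mul_self (σ : Pauli) (i : Fin n) : site σ i * site σ i = 1 := by
  rw [site_mul_site_self (ρ := .I) (c := 1) (by rw [σ.mat_mul_self, one_smul]; rfl), site_I,
    one_smul]

end Site

namespace PauliMon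

variable {n k : ℕ}

theorem isHermitian_op (A : PauliMon n k) : A.op.IsHermitian := by
  simp only [IsHermitian, op, conjTranspose_tensorOp, (Pauli.isHermitian_mat _).eq]

theorem op_mul_self (A : PauliMon n k) : A.op * A.op = 1 := by
  simp only [op, tensorOp_mul, Pauli.mat_mul_self, tensorOp_one]

theorem op_one : (one n k).op = 1 := tensorOp_one

theorem conjTranspose_op_mul_op (A B : PauliMon n k) : (A.op * B.op)ᴴ = B.op * A.op := by
  rw [conjTranspose_mul, A.isHermitian_op, B.isHermitian_op]

theorem isHermitian_op_mul_op_iff {A B : PauliMon n k} :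
    (A.op * B.op).IsHermitian ↔ Commute A.op B.op := by
  rw [IsHermitian, conjTranspose_op_mul_op, eq_comm, commute_iff_eq]

theorem op_commute_or_anticommute (A B : PauliMon n k) :
    Commute A.op B.op ∨ A.op * B.op = -(B.op * A.op) := by
  simp only [commute_iff_eq, op, tensorOp_mul]
  exact tensorOp_eq_or_eq_neg fun i => (A.1 i).mat_commute_or_anticommute (B.1 i)

theorem not_commute_op_of_anticommute {A B : PauliMon n k}
    (h : A.op * B.op = -(B.op * A.op)) : ¬Commute A.op B.op := by
  intro hcomm
  have hzero : A.op * B.op = 0 := by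
    ext s t
    exact self_eq_neg.mp (congrFun₂ (h.trans (congrArg Neg.neg hcomm.eq.symm)) s t)
  have hunit : IsUnit (A.op * B.op) :=
    (IsUnit.of_mul_eq_one _ A.op_mul_self).mul (IsUnit.of_mul_eq_one _ B.op_mul_self)
  exact hunit.ne_zero hzero

theorem op_pair (σ : Pauli) {i j : Fin n} (h : i ≠ j) :
    (pair σ i j).op = site σ i * site σ j := by
  rw [op, site, site, tensorOp_mul]
  congr 1
  funext k
  by_cases hi : k = i
  · subst hi
    simp [pair, h]
  · by_cases hj : k = j
    · subst hj
      simp [pair, hi]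
    · simp [pair, hi, hj, Pauli.mat]

theorem pair_comm (σ : Pauli) (i j : Fin n) : pair σ i j = pair σ j i := by
  simp only [pair, or_comm]

end PauliMon

section Energy

variable {n : ℕ} {A : Op n} {ψ : (Fin n → Fin 2) → ℂ}

theorem energy_le_lambdaMax (hA : A.IsHermitian) (hψ : star ψ ⬝ᵥ ψ = 1) :
    energy A ψ ≤ lambdaMax A :=
  re_star_dotProduct_mulVec_le_sSup_spectrum hA hψ

theorem exists_energy_eq_lambdaMax (hA : A.IsHermitian) :
    ∃ ψ : (Fin n → Fin 2) → ℂ, star ψ ⬝ᵥ ψ = 1 ∧ energy A ψ = lambdaMax A :=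
  exists_re_star_dotProduct_mulVec_eq_sSup_spectrum hA

theorem energy_add (A B : Op n) (ψ : (Fin n → Fin 2) → ℂ) :
    energy (A + B) ψ = energy A ψ + energy B ψ := by
  simp [energy, add_mulVec]

theorem energy_neg (A : Op n) (ψ : (Fin n → Fin 2) → ℂ) : energy (-A) ψ = -energy A ψ := by
  simp [energy, neg_mulVec]

theorem energy_sub (A B : Op n) (ψ : (Fin n → Fin 2) → ℂ) :
    energy (A - B) ψ = energy A ψ - energy B ψ := by
  rw [sub_eq_add_neg, energy_add, energy_neg, sub_eq_add_neg]

theorem energy_smul (c : ℝ) (A : Op n) (ψ : (Fin n → Fin 2) → ℂ) :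
    energy (c • A) ψ = c * energy A ψ := by
  simp [energy, smul_mulVec]

theorem energy_sum {ι : Type*} (s : Finset ι) (A : ι → Op n) (ψ : (Fin n → Fin 2) → ℂ) :
    energy (∑ i ∈ s, A i) ψ = ∑ i ∈ s, energy (A i) ψ := by
  simp only [energy, sum_mulVec, dotProduct_sum, Complex.re_sum]

theorem energy_conjTranspose (A : Op n) (ψ : (Fin n → Fin 2) → ℂ) :
    energy Aᴴ ψ = energy A ψ := by
  rw [energy, energy, dotProduct_mulVec, ← star_mulVec, star_dotProduct]
  simp

end Energy

section Hamiltonian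

variable {n : ℕ} {G : SimpleGraph (Fin n)}

theorem mem_edges {e : Fin n × Fin n} : e ∈ edges G ↔ e.1 < e.2 ∧ G.Adj e.1 e.2 := by
  simp [edges]

theorem ne_of_mem_edges {e : Fin n × Fin n} (he : e ∈ edges G) : e.1 ≠ e.2 :=
  (mem_edges.mp he).1.ne

theorem isHermitian_edgeHam {i j : Fin n} (h : i ≠ j) : (edgeHam i j).IsHermitian := by
  have hpair : ∀ σ : Pauli, (site σ i * site σ j).IsHermitian := fun σ =>
    PauliMon.op_pair σ h ▸ PauliMon.isHermitian_op _
  exact ((((hpair _).add (hpair _)).sub (hpair _)).add (hpair _)).smul (IsSelfAdjoint.all _)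

theorem isHermitian_eprHam (G : SimpleGraph (Fin n)) (w : Fin n × Fin n → ℝ) :
    (eprHam G w).IsHermitian :=
  sum_induction _ IsHermitian (fun _ _ => IsHermitian.add) isHermitian_zero fun _ he =>
    (isHermitian_edgeHam (ne_of_mem_edges he)).smul (IsSelfAdjoint.all _)

end Hamiltonian

section StateMoment

variable {n k : ℕ} {ψ : (Fin n → Fin 2) → ℂ}

/-- The level-`k` moment matrix of the state `ψ`, in which `L` is the expectation in `ψ`. It is how
physical states enter the relaxation. -/
def stateMoment (k : ℕ) (ψ : (Fin n → Fin 2) → ℂ) : Matrix (PauliMon n k) (PauliMon n k) ℝ :=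
  of fun A B => energy (A.op * B.op) ψ

theorem stateMoment_eq_gram :
    stateMoment k ψ = gram ℝ fun A : PauliMon n k => WithLp.toLp 2 (A.op *ᵥ ψ) := by
  ext A B
  have hdot : star ψ ⬝ᵥ (A.op * B.op) *ᵥ ψ = star (A.op *ᵥ ψ) ⬝ᵥ B.op *ᵥ ψ := by
    rw [star_mulVec, A.isHermitian_op, ← dotProduct_mulVec, mulVec_mulVec]
  rw [stateMoment, of_apply, energy, hdot, gram_apply, PiLp.inner_apply, dotProduct,
    Complex.re_sum]
  exact sum_congr rfl fun s _ => congrArg Complex.re (mul_comm _ _)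

theorem isMoment_stateMoment (hψ : star ψ ⬝ᵥ ψ = 1) : IsMoment (stateMoment k ψ) where
  psd := stateMoment_eq_gram ▸ posSemidef_gram _ _
  eq_of_eq A B A' B' h := congrArg (energy · ψ) h
  eq_neg_of_eq_neg A B A' B' h := (congrArg (energy · ψ) h).trans (energy_neg _ ψ)
  eq_zero A B h := by
    have hanti := (A.op_commute_or_anticommute B).resolve_left
      (PauliMon.isHermitian_op_mul_op_iff.not.mp h)
    have hneg := energy_conjTranspose (A.op * B.op) ψ
    rw [PauliMon.conjTranspose_op_mul_op, hanti, energy_neg, eq_comm, neg_eq_self] at hneg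
    rw [stateMoment, of_apply, hanti, energy_neg, hneg, neg_zero]
  diag A := by simp [stateMoment, PauliMon.op_mul_self, energy, hψ]

end StateMoment

section Relaxation

variable {n k : ℕ} {G : SimpleGraph (Fin n)} {w : Fin n × Fin n → ℝ}

theorem energy_eprHam (ψ : (Fin n → Fin 2) → ℂ) :
    energy (eprHam G w) ψ = sdpObjective G w (stateMoment 2 ψ) := by
  rw [eprHam, energy_sum]
  refine sum_congr rfl fun e he => ?_
  simp only [energy_smul, edgeHam, energy_add, energy_sub, pseudoExp, stateMoment, of_apply,
    PauliMon.op_one, mul_one, PauliMon.op_pair _ (ne_of_mem_edges he), site_I]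

theorem IsMoment.sdpObjective_eq_upper {Γ : Matrix (PauliMon n 2) (PauliMon n 2) ℝ}
    (hΓ : IsMoment Γ) : sdpObjective G w Γ = upper G w Γ := by
  refine sum_congr rfl fun e _ => ?_
  rw [gval, show pseudoExp Γ (.one n 2) = 1 from hΓ.diag _]
  ring

theorem IsSDPSolution.lambdaMax_le_upper {Γ : Matrix (PauliMon n 2) (PauliMon n 2) ℝ}
    (hΓ : IsSDPSolution G w Γ) : lambdaMax (eprHam G w) ≤ upper G w Γ := by
  obtain ⟨ψ, hψ, hmax⟩ := exists_energy_eq_lambdaMax (isHermitian_eprHam G w)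
  rw [← hmax, energy_eprHam, ← hΓ.1.sdpObjective_eq_upper]
  exact hΓ.2 _ (isMoment_stateMoment hψ)

theorem isClosed_setOf_isMoment :
    IsClosed {Γ : Matrix (PauliMon n k) (PauliMon n k) ℝ | IsMoment Γ} := by
  have hentry : ∀ A B, Continuous fun Γ : Matrix (PauliMon n k) (PauliMon n k) ℝ => Γ A B :=
    fun A B => continuous_id.matrix_elem A B
  have hiff : ∀ Γ : Matrix (PauliMon n k) (PauliMon n k) ℝ, IsMoment Γ ↔ Γ.PosSemidef ∧
      (∀ A B A' B' : PauliMon n k, A.op * B.op = A'.op * B'.op → Γ A B = Γ A' B') ∧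
      (∀ A B A' B' : PauliMon n k, A.op * B.op = -(A'.op * B'.op) → Γ A B = -Γ A' B') ∧
      (∀ A B : PauliMon n k, ¬(A.op * B.op).IsHermitian → Γ A B = 0) ∧ ∀ A, Γ A A = 1 :=
    fun Γ => ⟨fun ⟨h₁, h₂, h₃, h₄, h₅⟩ => ⟨h₁, h₂, h₃, h₄, h₅⟩,
      fun ⟨h₁, h₂, h₃, h₄, h₅⟩ => ⟨h₁, h₂, h₃, h₄, h₅⟩⟩
  simp only [hiff, Set.ofPred_and, Set.ofPred_forall]
  refine isClosed_setOf_posSemidef.inter (.inter ?_ (.inter ?_ (.inter ?_ ?_)))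
  · exact isClosed_iInter fun A => isClosed_iInter fun B => isClosed_iInter fun A' =>
      isClosed_iInter fun B' => isClosed_iInter fun _ => isClosed_eq (hentry A B) (hentry A' B')
  · exact isClosed_iInter fun A => isClosed_iInter fun B => isClosed_iInter fun A' =>
      isClosed_iInter fun B' => isClosed_iInter fun _ =>
        isClosed_eq (hentry A B) (hentry A' B').neg
  · exact isClosed_iInter fun A => isClosed_iInter fun B => isClosed_iInter fun _ =>
      isClosed_eq (hentry A B) continuous_const
  · exact isClosed_iInter fun A => isClosed_eq (hentry A A) continuous_const

theorem isCompact_setOf_isMoment :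
    IsCompact {Γ : Matrix (PauliMon n k) (PauliMon n k) ℝ | IsMoment Γ} := by
  refine IsCompact.of_isClosed_subset
    (isCompact_univ_pi fun _ => isCompact_univ_pi fun _ => isCompact_Icc (a := (-1 : ℝ)) (b := 1))
    isClosed_setOf_isMoment fun Γ hΓ A _ B _ => ?_
  exact abs_le.mp (abs_apply_le_one hΓ.psd hΓ.diag A B)

theorem continuous_sdpObjective : Continuous (sdpObjective G w) := by
  unfold sdpObjective pseudoExp
  fun_prop

end Relaxation

section ZeroState

variable {n : ℕ}

/-- The computational basis state `|0…0⟩` on which the circuit acts. -/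
def zeroState (n : ℕ) : (Fin n → Fin 2) → ℂ := Pi.single 0 1

theorem star_zeroState_dotProduct_self : star (zeroState n) ⬝ᵥ zeroState n = 1 := by
  simp [zeroState, Pi.star_single]

theorem exists_isSDPSolution (G : SimpleGraph (Fin n)) (w : Fin n × Fin n → ℝ) :
    ∃ Γ, IsSDPSolution G w Γ := by
  obtain ⟨Γ, hΓ, hmax⟩ := isCompact_setOf_isMoment.exists_isMaxOn
    ⟨_, isMoment_stateMoment (star_zeroState_dotProduct_self (n := n))⟩
    (continuous_sdpObjective (G := G) (w := w)).continuousOn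
  exact ⟨Γ, hΓ, fun _ hΓ' => hmax hΓ'⟩

theorem energy_zeroState (A : Op n) : energy A (zeroState n) = (A 0 0).re := by
  simp [energy, zeroState, Pi.star_single]

theorem op_pair_apply_zero (σ : Pauli) {i j : Fin n} (hij : i ≠ j) :
    (PauliMon.pair σ i j).op 0 0 = σ.mat 0 0 ^ 2 := by
  have hfactor : ∀ k, ((PauliMon.pair σ i j).1 k).mat 0 0 =
      if k ∈ ({i, j} : Finset (Fin n)) then σ.mat 0 0 else 1 := fun k => by
    simp only [PauliMon.pair, mem_insert, mem_singleton]
    split_ifs <;> simp [Pauli.mat]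
  simp only [PauliMon.op, tensorOp, of_apply, Pi.zero_apply, hfactor]
  rw [prod_ite_mem, univ_inter, prod_const, card_pair hij]

theorem energy_edgeHam_zeroState {i j : Fin n} (hij : i ≠ j) :
    energy (edgeHam i j) (zeroState n) = 1 := by
  rw [edgeHam, energy_smul, energy_zeroState]
  simp only [← PauliMon.op_pair _ hij, Matrix.add_apply, Matrix.sub_apply, op_pair_apply_zero _ hij]
  norm_num [Pauli.mat]

theorem sum_weight_le_lambdaMax (G : SimpleGraph (Fin n)) (w : Fin n × Fin n → ℝ) :
    ∑ e ∈ edges G, w e ≤ lambdaMax (eprHam G w) := by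
  refine le_of_eq_of_le ?_
    (energy_le_lambdaMax (isHermitian_eprHam G w) star_zeroState_dotProduct_self)
  rw [eprHam, energy_sum]
  exact sum_congr rfl fun e he => by
    rw [energy_smul, energy_edgeHam_zeroState (ne_of_mem_edges he), mul_one]

end ZeroState

/-! ### Gram vectors of a level-two moment matrix -/

namespace PauliMon

variable {n : ℕ} {i j k : Fin n}

theorem pair_mul_pair {σ τ ρ : Pauli} {c : ℂ} (h : σ.mat * τ.mat = c • ρ.mat) (hij : i ≠ j) :
    (pair σ i j).op * (pair τ i j).op = c ^ 2 • (pair ρ i j).op := by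
  rw [op_pair _ hij, op_pair _ hij, op_pair _ hij, (site_commute _ _ hij.symm).mul_mul_mul_comm,
    site_mul_site_self h, site_mul_site_self h, smul_mul_smul_comm, sq]

theorem pair_mul_pair_of_ne (σ : Pauli) (hij : i ≠ j) (hik : i ≠ k) (hjk : j ≠ k) :
    (pair σ i j).op * (pair σ i k).op = (pair σ j k).op := by
  rw [op_pair _ hij, op_pair _ hik, op_pair _ hjk, (site_commute σ σ hij).eq, mul_assoc,
    ← mul_assoc (site σ i), site_mul_self, one_mul]

theorem pair_anticommute {σ τ : Pauli} (hij : i ≠ j) (hjk : j ≠ k) (hσ : σ ≠ .I) (hτ : τ ≠ .I)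
    (hne : σ ≠ τ) :
    (pair σ i j).op * (pair τ i k).op = -((pair τ i k).op * (pair σ i j).op) := by
  rw [← neg_one_smul ℂ]
  simp only [op, tensorOp_mul]
  refine tensorOp_eq_smul_of_forall_ne (i := i) ?_ fun l hl => ?_
  · simpa [pair] using Pauli.mat_mul_mat_eq_neg hσ hτ hne
  · by_cases hlj : l = j
    · subst hlj
      simp [pair, hl, hjk, Pauli.mat]
    · simp [pair, hl, hlj, Pauli.mat]

end PauliMon

namespace IsMoment

variable {n : ℕ} {Γ : Matrix (PauliMon n 2) (PauliMon n 2) ℝ} {i j k : Fin n}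

theorem symm (hΓ : IsMoment Γ) (A B : PauliMon n 2) : Γ A B = Γ B A :=
  hΓ.psd.1.apply B A

theorem pair_pair_of_ne (hΓ : IsMoment Γ) (σ : Pauli) (hij : i ≠ j) (hik : i ≠ k)
    (hjk : j ≠ k) : Γ (.pair σ i j) (.pair σ i k) = pseudoExp Γ (.pair σ j k) :=
  hΓ.eq_of_eq _ _ _ _ <| by
    rw [PauliMon.pair_mul_pair_of_ne σ hij hik hjk, PauliMon.op_one, mul_one]

theorem pair_pair_eq_zero (hΓ : IsMoment Γ) {σ τ : Pauli} (hij : i ≠ j) (hjk : j ≠ k)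
    (hσ : σ ≠ .I) (hτ : τ ≠ .I) (hne : σ ≠ τ) : Γ (.pair σ i j) (.pair τ i k) = 0 :=
  hΓ.eq_zero _ _ <| PauliMon.isHermitian_op_mul_op_iff.not.mpr <|
    PauliMon.not_commute_op_of_anticommute <| PauliMon.pair_anticommute hij hjk hσ hτ hne

theorem pair_pair_eq_neg (hΓ : IsMoment Γ) {σ τ ρ : Pauli} {c : ℂ}
    (h : σ.mat * τ.mat = c • ρ.mat) (hc : c ^ 2 = -1) (hij : i ≠ j) :
    Γ (.pair σ i j) (.pair τ i j) = -pseudoExp Γ (.pair ρ i j) :=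
  hΓ.eq_neg_of_eq_neg _ _ _ _ <| by
    rw [PauliMon.pair_mul_pair h hij, hc, PauliMon.op_one, mul_one, neg_one_smul]

end IsMoment

theorem gval_comm {n : ℕ} (Γ : Matrix (PauliMon n 2) (PauliMon n 2) ℝ) (i j : Fin n) :
    gval Γ i j = gval Γ j i := by
  simp only [gval, PauliMon.pair_comm _ i j]

/-- The pseudo-expectation of the operator `(I_i I_j + X_i X_j + Y_i Y_j + Z_i Z_j) / 2` that
swaps the qubits `i` and `j`. -/
def swapVal {n : ℕ} (Γ : Matrix (PauliMon n 2) (PauliMon n 2) ℝ) (i j : Fin n) : ℝ :=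
  (1 + pseudoExp Γ (.pair .X i j) + pseudoExp Γ (.pair .Y i j) + pseudoExp Γ (.pair .Z i j)) / 2

theorem swapVal_comm {n : ℕ} (Γ : Matrix (PauliMon n 2) (PauliMon n 2) ℝ) (i j : Fin n) :
    swapVal Γ i j = swapVal Γ j i := by
  simp only [swapVal, PauliMon.pair_comm _ i j]

section Gram

variable {n : ℕ} {E : Type*} [NormedAddCommGroup E] [InnerProductSpace ℝ E]
  {u : PauliMon n 2 → E} {i j k : Fin n}

/-- The combination of Gram vectors that represents the reflection `h_{ij} - 1`, whose
pseudo-expectation is `g_{ij}`. -/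
def edgeVec (u : PauliMon n 2 → E) (i j : Fin n) : E :=
  (1 / 2 : ℝ) • (-u (.one n 2) + u (.pair .X i j) - u (.pair .Y i j) + u (.pair .Z i j))

/-- The combination of Gram vectors that represents the swap of the qubits `i` and `j`. -/
def swapVec (u : PauliMon n 2 → E) (i j : Fin n) : E :=
  (1 / 2 : ℝ) • (u (.one n 2) + u (.pair .X i j) + u (.pair .Y i j) + u (.pair .Z i j))

theorem edgeVec_comm (u : PauliMon n 2 → E) (i j : Fin n) : edgeVec u i j = edgeVec u j i := by
  simp only [edgeVec, PauliMon.pair_comm _ i j]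

theorem swapVec_comm (u : PauliMon n 2 → E) (i j : Fin n) : swapVec u i j = swapVec u j i := by
  simp only [swapVec, PauliMon.pair_comm _ i j]

theorem norm_one_eq_one (hu : IsMoment (gram ℝ u)) : ‖u (.one n 2)‖ = 1 := by
  rw [norm_eq_sqrt_real_inner, ← gram_apply (𝕜 := ℝ) u, hu.diag, Real.sqrt_one]

theorem inner_one_edgeVec (hu : IsMoment (gram ℝ u)) (i j : Fin n) :
    inner ℝ (u (.one n 2)) (edgeVec u i j) = gval (gram ℝ u) i j := by
  simp only [edgeVec, gval, inner_add_right, inner_sub_right, inner_neg_right, inner_smul_right,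
    ← gram_apply (𝕜 := ℝ) u, hu.diag, hu.symm (.one n 2), pseudoExp]
  ring

theorem inner_one_swapVec (hu : IsMoment (gram ℝ u)) (i j : Fin n) :
    inner ℝ (u (.one n 2)) (swapVec u i j) = swapVal (gram ℝ u) i j := by
  simp only [swapVec, swapVal, inner_add_right, inner_smul_right,
    ← gram_apply (𝕜 := ℝ) u, hu.diag, hu.symm (.one n 2), pseudoExp]
  ring

theorem norm_edgeVec (hu : IsMoment (gram ℝ u)) (hij : i ≠ j) : ‖edgeVec u i j‖ = 1 := by
  have hXY := hu.pair_pair_eq_neg Pauli.mat_X_mul_Y (by simp) hij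
  have hXZ := hu.pair_pair_eq_neg Pauli.mat_X_mul_Z (by simp) hij
  have hYZ := hu.pair_pair_eq_neg Pauli.mat_Y_mul_Z (by simp) hij
  rw [norm_eq_sqrt_real_inner, Real.sqrt_eq_one]
  simp only [edgeVec, inner_add_right, inner_sub_right, inner_neg_right, inner_smul_right,
    inner_add_left, inner_sub_left, inner_neg_left, real_inner_smul_left,
    ← gram_apply (𝕜 := ℝ) u, hu.diag, hu.symm (.one n 2), hXY, hXZ, hYZ,
    hu.symm (.pair .Y i j) (.pair .X i j), hu.symm (.pair .Z i j) (.pair _ i j),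
    pseudoExp]
  ring

theorem norm_swapVec (hu : IsMoment (gram ℝ u)) (hij : i ≠ j) : ‖swapVec u i j‖ = 1 := by
  have hXY := hu.pair_pair_eq_neg Pauli.mat_X_mul_Y (by simp) hij
  have hXZ := hu.pair_pair_eq_neg Pauli.mat_X_mul_Z (by simp) hij
  have hYZ := hu.pair_pair_eq_neg Pauli.mat_Y_mul_Z (by simp) hij
  rw [norm_eq_sqrt_real_inner, Real.sqrt_eq_one]
  simp only [swapVec, inner_add_right, inner_smul_right, inner_add_left, real_inner_smul_left,
    ← gram_apply (𝕜 := ℝ) u, hu.diag, hu.symm (.one n 2), hXY, hXZ, hYZ,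
    hu.symm (.pair .Y i j) (.pair .X i j), hu.symm (.pair .Z i j) (.pair _ i j),
    pseudoExp]
  ring

theorem inner_edgeVec_edgeVec (hu : IsMoment (gram ℝ u)) (hij : i ≠ j) (hik : i ≠ k)
    (hjk : j ≠ k) : inner ℝ (edgeVec u i j) (edgeVec u i k) =
      (swapVal (gram ℝ u) j k - 1 - gval (gram ℝ u) i j - gval (gram ℝ u) i k) / 2 := by
  simp only [edgeVec, inner_add_right, inner_sub_right, inner_neg_right, inner_smul_right,
    inner_add_left, inner_sub_left, inner_neg_left, real_inner_smul_left,
    ← gram_apply (𝕜 := ℝ) u, hu.pair_pair_of_ne _ hij hik hjk, hu.pair_pair_eq_zero hij hjk,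
    ne_eq, reduceCtorEq, not_false_eq_true, hu.diag, hu.symm (.one n 2), pseudoExp,
    swapVal, gval]
  ring

theorem inner_edgeVec_swapVec (hu : IsMoment (gram ℝ u)) (hij : i ≠ j) (hik : i ≠ k)
    (hjk : j ≠ k) : inner ℝ (edgeVec u i j) (swapVec u j k) =
      (1 + gval (gram ℝ u) i j + gval (gram ℝ u) i k - swapVal (gram ℝ u) j k) / 2 := by
  rw [edgeVec_comm, gval_comm _ i j]
  simp only [edgeVec, swapVec, inner_add_right, inner_smul_right,
    inner_add_left, inner_sub_left, inner_neg_left, real_inner_smul_left,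
    ← gram_apply (𝕜 := ℝ) u, hu.pair_pair_of_ne _ hij.symm hjk hik,
    hu.pair_pair_eq_zero hij.symm hik, ne_eq, reduceCtorEq, not_false_eq_true, hu.diag,
    hu.symm (.one n 2), pseudoExp, swapVal, gval]
  ring

end Gram

/-! ### Monogamy inequalities -/

section InnerProduct

variable {E : Type*} [NormedAddCommGroup E] [InnerProductSpace ℝ E]

theorem sq_inner_sub_inner_mul_inner_le {e : E} (he : ‖e‖ = 1) (v w : E) :
    (inner ℝ v w - inner ℝ e v * inner ℝ e w) ^ 2 ≤
      (‖v‖ ^ 2 - inner ℝ e v ^ 2) * (‖w‖ ^ 2 - inner ℝ e w ^ 2) := by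
  have hproj (x y : E) : inner ℝ (x - inner ℝ e x • e) (y - inner ℝ e y • e) =
      inner ℝ x y - inner ℝ e x * inner ℝ e y := by
    simp only [inner_sub_left, inner_sub_right, real_inner_smul_left, real_inner_smul_right,
      real_inner_self_eq_norm_sq, he, real_inner_comm e]
    ring
  have hcs := real_inner_mul_inner_self_le (v - inner ℝ e v • e) (w - inner ℝ e w • e)
  simpa only [hproj, real_inner_self_eq_norm_sq, ← sq] using hcs

/-- Bessel's inequality in the plane spanned by two vectors at an angle of `2π/3`. -/
theorem sq_inner_add_inner_mul_inner_add_sq_inner_le {x y z : E} {s : ℝ} (hx : ‖x‖ ^ 2 = s)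
    (hy : ‖y‖ ^ 2 = s) (hz : ‖z‖ ^ 2 = s) (hyz : inner ℝ y z = -s / 2) :
    4 * (inner ℝ x y ^ 2 + inner ℝ x y * inner ℝ x z + inner ℝ x z ^ 2) ≤ 3 * s ^ 2 := by
  set a := inner ℝ x y with ha
  set b := inner ℝ x z with hb
  set F := a ^ 2 + a * b + b ^ 2 with hF
  set v := (2 * a + b) • y + (2 * b + a) • z with hv
  have hxv : inner ℝ x v = 2 * F := by
    rw [hv, inner_add_right, real_inner_smul_right, real_inner_smul_right, ← ha, ← hb, hF]
    ring
  have hvv : inner ℝ v v = 3 * s * F := by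
    rw [real_inner_self_eq_norm_sq, hv, norm_add_sq_real, norm_smul, norm_smul, mul_pow, mul_pow,
      hy, hz, real_inner_smul_left, real_inner_smul_right, hyz, Real.norm_eq_abs,
      Real.norm_eq_abs, sq_abs, sq_abs, hF]
    ring
  have hcs := real_inner_mul_inner_self_le x v
  rw [hxv, hvv, real_inner_self_eq_norm_sq, hx] at hcs
  have hF0 : 0 ≤ F := by nlinarith [sq_nonneg (a + b), sq_nonneg a, sq_nonneg b]
  rcases hF0.eq_or_lt with hF0 | hF0
  · linarith [sq_nonneg s]
  · exact le_of_mul_le_mul_left (by linarith) hF0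

end InnerProduct

section Monogamy

variable {n : ℕ} {E : Type*} [NormedAddCommGroup E] [InnerProductSpace ℝ E]
  {u : PauliMon n 2 → E} {Γ : Matrix (PauliMon n 2) (PauliMon n 2) ℝ} {i j k : Fin n}
  {K : Finset (Fin n)}

theorem abs_gval_le_one (hΓ : IsMoment Γ) (hij : i ≠ j) : |gval Γ i j| ≤ 1 := by
  obtain ⟨u, rfl⟩ := exists_gram_eq hΓ.psd
  simpa only [inner_one_edgeVec hΓ, norm_one_eq_one hΓ, norm_edgeVec hΓ hij, mul_one]
    using abs_real_inner_le_norm (u (.one n 2)) (edgeVec u i j)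

theorem swapVal_le_one (hu : IsMoment (gram ℝ u)) (hij : i ≠ j) :
    swapVal (gram ℝ u) i j ≤ 1 := by
  simpa only [inner_one_swapVec hu, norm_one_eq_one hu, norm_swapVec hu hij, mul_one]
    using real_inner_le_norm (u (.one n 2)) (swapVec u i j)

theorem inner_edgeVec_sum_edgeVec_le (hu : IsMoment (gram ℝ u)) (hij : i ≠ j) (hi : i ∉ K)
    (hj : j ∉ K) : inner ℝ (edgeVec u i j) (∑ k ∈ K, edgeVec u i k) ≤
      -((#K * gval (gram ℝ u) i j + ∑ k ∈ K, gval (gram ℝ u) i k) / 2) := by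
  rw [← nsmul_eq_mul, ← sum_const, ← sum_add_distrib, sum_div, ← sum_neg_distrib, inner_sum]
  refine sum_le_sum fun k hk => ?_
  have hjk : j ≠ k := ne_of_mem_of_not_mem hk hj |>.symm
  rw [inner_edgeVec_edgeVec hu hij (ne_of_mem_of_not_mem hk hi).symm hjk]
  linarith [swapVal_le_one hu hjk]

theorem norm_sum_edgeVec_sq_le (hu : IsMoment (gram ℝ u)) (hi : i ∉ K) :
    ‖∑ k ∈ K, edgeVec u i k‖ ^ 2 ≤ #K - (#K - 1) * ∑ k ∈ K, gval (gram ℝ u) i k := by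
  induction K using Finset.induction_on with
  | empty => simp
  | insert a K ha ih =>
    obtain ⟨hia, hiK⟩ : i ≠ a ∧ i ∉ K := by simpa using hi
    rw [sum_insert ha, sum_insert ha, card_insert_of_notMem ha, norm_add_sq_real,
      norm_edgeVec hu hia]
    push_cast
    linarith [ih hiK, inner_edgeVec_sum_edgeVec_le hu hia hiK ha]

theorem inner_one_sum_edgeVec (hu : IsMoment (gram ℝ u)) (i : Fin n) (K : Finset (Fin n)) :
    inner ℝ (u (.one n 2)) (∑ k ∈ K, edgeVec u i k) = ∑ k ∈ K, gval (gram ℝ u) i k := by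
  simp only [inner_sum, inner_one_edgeVec hu]

theorem sum_gval_le_one (hΓ : IsMoment Γ) (hi : i ∉ K) : ∑ k ∈ K, gval Γ i k ≤ 1 := by
  obtain ⟨u, rfl⟩ := exists_gram_eq hΓ.psd
  have hcs := real_inner_mul_inner_self_le (u (.one n 2)) (∑ k ∈ K, edgeVec u i k)
  simp only [inner_one_sum_edgeVec hΓ, real_inner_self_eq_norm_sq, norm_one_eq_one hΓ] at hcs
  set x := ∑ k ∈ K, gval (gram ℝ u) i k
  have hstar : x * x ≤ #K - (#K - 1) * x := by linarith [norm_sum_edgeVec_sq_le hΓ hi]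
  by_contra! hx
  nlinarith [mul_pos (sub_pos.mpr hx) (by positivity : 0 < x + #K)]

theorem sum_gval_sq_le (hΓ : IsMoment Γ) (hij : i ≠ j) (hi : i ∉ K) (hj : j ∉ K)
    (hnn : 0 ≤ (#K * gval Γ i j + ∑ k ∈ K, gval Γ i k) / 2 +
      gval Γ i j * ∑ k ∈ K, gval Γ i k) :
    ((#K * gval Γ i j + ∑ k ∈ K, gval Γ i k) / 2 + gval Γ i j * ∑ k ∈ K, gval Γ i k) ^ 2 ≤
      (1 - gval Γ i j ^ 2) *
        (#K - (#K - 1) * (∑ k ∈ K, gval Γ i k) - (∑ k ∈ K, gval Γ i k) ^ 2) := by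
  obtain ⟨u, rfl⟩ := exists_gram_eq hΓ.psd
  have hgram := sq_inner_sub_inner_mul_inner_le (norm_one_eq_one hΓ) (edgeVec u i j)
    (∑ k ∈ K, edgeVec u i k)
  rw [inner_one_sum_edgeVec hΓ, inner_one_edgeVec hΓ, norm_edgeVec hΓ hij, one_pow,
    ← neg_sq] at hgram
  have hy : 0 ≤ 1 - gval (gram ℝ u) i j ^ 2 := by
    simpa using (sq_le_one_iff_abs_le_one _).mpr (abs_gval_le_one hΓ hij)
  calc _ ≤ _ := pow_le_pow_left₀ hnn
        (by linarith [inner_edgeVec_sum_edgeVec_le hΓ hij hi hj]) 2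
    _ ≤ _ := hgram
    _ ≤ _ := by gcongr; exact norm_sum_edgeVec_sq_le hΓ hi

theorem le_R_of_ellipse {a b t : ℝ} (ha : -1 ≤ a) (ht : 0 ≤ t)
    (h : 4 * ((a + t) ^ 2 + (a + t) * (b + t) + (b + t) ^ 2) ≤ 3 * (1 - t) ^ 2) : b ≤ R a := by
  suffices 2 * b + a ≤ √(3 * (1 - a ^ 2)) by
    unfold R
    linarith
  rcases le_total (2 * b + a) 0 with hab | hab
  · exact hab.trans (Real.sqrt_nonneg _)
  · apply Real.le_sqrt_of_sq_le
    nlinarith [mul_nonneg ht (by linarith : 0 ≤ 6 + 12 * (a + b)), sq_nonneg t]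

/-- The vectors `A + p` and `B + p` span a plane orthogonal to `p` and make an angle of `2π/3`, so
Bessel's inequality applies to `e - p`. -/
theorem inner_le_R_inner {e A B p : E} {t : ℝ} (he : ‖e‖ = 1) (hA : ‖A‖ = 1) (hB : ‖B‖ = 1)
    (hp : ‖p‖ ^ 2 = t) (hep : inner ℝ e p = t) (hAp : inner ℝ A p = -t) (hBp : inner ℝ B p = -t)
    (hAB : inner ℝ A B = (3 * t - 1) / 2) : inner ℝ e B ≤ R (inner ℝ e A) := by
  have heA : -1 ≤ inner ℝ e A := by
    simpa [he, hA] using (abs_le.mp (abs_real_inner_le_norm e A)).1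
  have hpB : inner ℝ p B = -t := by rw [real_inner_comm, hBp]
  have hpA : inner ℝ p A = -t := by rw [real_inner_comm, hAp]
  have hbessel := sq_inner_add_inner_mul_inner_add_sq_inner_le (x := e - p) (y := A + p)
    (z := B + p) (s := 1 - t) (by rw [norm_sub_sq_real, he, hep, hp]; ring)
    (by rw [norm_add_sq_real, hA, hAp, hp]; ring)
    (by rw [norm_add_sq_real, hB, hBp, hp]; ring)
    (by
      rw [inner_add_left, inner_add_right, inner_add_right, hAB, hAp, hpB,
        real_inner_self_eq_norm_sq, hp]
      ring)
  simp only [inner_sub_left, inner_add_right, hep, hpA, hpB, real_inner_self_eq_norm_sq, hp]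
    at hbessel
  exact le_R_of_ellipse heA (hp ▸ sq_nonneg ‖p‖) (by linarith)

theorem gval_le_R (hΓ : IsMoment Γ) (hij : i ≠ j) (hik : i ≠ k) (hjk : j ≠ k) :
    gval Γ i k ≤ R (gval Γ i j) := by
  obtain ⟨u, rfl⟩ := exists_gram_eq hΓ.psd
  have hAB := inner_edgeVec_edgeVec hΓ hij hik hjk
  have hAC := inner_edgeVec_swapVec hΓ hij hik hjk
  have hBC := inner_edgeVec_swapVec hΓ hik hij hjk.symm
  rw [swapVec_comm, swapVal_comm] at hBC
  have hAA := norm_edgeVec hΓ hij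
  have hBB := norm_edgeVec hΓ hik
  have hCC := norm_swapVec hΓ hjk
  rw [← inner_one_edgeVec hΓ i k, ← inner_one_edgeVec hΓ i j]
  set p := (1 / 3 : ℝ) • (swapVec u j k - edgeVec u i j - edgeVec u i k) with hp
  set t := (swapVal (gram ℝ u) j k - gval (gram ℝ u) i j - gval (gram ℝ u) i k) / 3 with ht
  have hAp : inner ℝ (edgeVec u i j) p = -t := by
    simp only [hp, inner_sub_right, real_inner_smul_right, real_inner_self_eq_norm_sq, hAA, hAB,
      hAC]
    linarith
  have hBp : inner ℝ (edgeVec u i k) p = -t := by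
    rw [real_inner_comm] at hAB
    simp only [hp, inner_sub_right, real_inner_smul_right, real_inner_self_eq_norm_sq, hBB, hAB,
      hBC]
    linarith
  have hCp : inner ℝ (swapVec u j k) p = t := by
    rw [real_inner_comm] at hAC hBC
    simp only [hp, inner_sub_right, real_inner_smul_right, real_inner_self_eq_norm_sq, hCC, hAC,
      hBC]
    linarith
  refine inner_le_R_inner (norm_one_eq_one hΓ) hAA hBB ?_ ?_ hAp hBp (by linarith)
  · rw [← real_inner_self_eq_norm_sq]
    nth_rw 1 [hp]
    simp only [real_inner_smul_left, inner_sub_left, hAp, hBp, hCp]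
    ring
  · simp only [hp, inner_sub_right, real_inner_smul_right, inner_one_edgeVec hΓ,
      inner_one_swapVec hΓ]
    linarith

end Monogamy

/-! ### The star bound -/

theorem antitoneOn_R : AntitoneOn R (Set.Ici 0) := fun x (hx : 0 ≤ x) y _ hxy => by
  have : √(3 * (1 - y ^ 2)) ≤ √(3 * (1 - x ^ 2)) := by gcongr
  unfold R
  linarith

theorem R_one_half : R (1 / 2) = 1 / 2 := by
  rw [R, show (3 : ℝ) * (1 - (1 / 2) ^ 2) = (3 / 2) ^ 2 by norm_num, Real.sqrt_sq (by norm_num)]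
  norm_num

theorem R_sqrt_three_div_two : R (√3 / 2) = 0 := by
  rw [R, div_pow, Real.sq_sqrt (by norm_num),
    show (3 : ℝ) * (1 - 3 / 2 ^ 2) = 3 / 2 ^ 2 by norm_num, Real.sqrt_div' _ (by norm_num),
    Real.sqrt_sq (by norm_num), sub_self, zero_div]

theorem R_le_one_half {x : ℝ} (hx : 1 / 2 ≤ x) : R x ≤ 1 / 2 :=
  (antitoneOn_R (Set.mem_Ici.mpr (by norm_num)) (Set.mem_Ici.mpr (by linarith)) hx).trans_eq
    R_one_half

theorem R_nonneg {x : ℝ} (hx : 0 ≤ x) (hx' : x ≤ √3 / 2) : 0 ≤ R x :=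
  R_sqrt_three_div_two.symm.trans_le (antitoneOn_R hx (hx.trans hx') hx')

theorem R_nonpos {x : ℝ} (hx : √3 / 2 ≤ x) : R x ≤ 0 :=
  (antitoneOn_R (Set.mem_Ici.mpr (by positivity)) (Set.mem_Ici.mpr (le_trans (by positivity) hx))
    hx).trans_eq R_sqrt_three_div_two

theorem Q_le_one {x : ℝ} (hx : 0 ≤ x) : Q x ≤ 1 := by
  unfold Q
  split_ifs with h
  · linarith
  · linarith [R_le_one_half (not_le.mp h).le]
  · exact zero_le_one

theorem pos_nonneg (x : ℝ) : 0 ≤ pos x := le_max_right _ _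

theorem pos_of_nonneg {x : ℝ} (hx : 0 ≤ x) : pos x = x := max_eq_left hx

theorem pos_of_nonpos {x : ℝ} (hx : x ≤ 0) : pos x = 0 := max_eq_right hx

theorem le_R_of_star_inequality {p x y : ℝ} (hp : 2 ≤ p) (hx : 0 ≤ x) (hy : 1 / 2 ≤ y)
    (hxy : x + y ≤ 1)
    (h : ((p * y + x) / 2 + y * x) ^ 2 ≤ (1 - y ^ 2) * (p - (p - 1) * x - x ^ 2)) : x ≤ R y := by
  by_contra! hR
  have hellipse : 3 / 4 < x ^ 2 + x * y + y ^ 2 := by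
    have hsqrt : √(3 * (1 - y ^ 2)) < 2 * x + y := by
      unfold R at hR
      linarith
    linarith [(Real.sqrt_lt' (by linarith)).mp hsqrt]
  -- The inequality is quadratic in `p`; it fails at `p = 2`, and increasingly so for larger `p`.
  have hx2 : x ^ 2 ≤ x / 2 := by nlinarith
  have hxy4 : x * y ≤ 1 / 4 := by nlinarith [sq_nonneg (x - y)]
  have hslope : 0 ≤ 8 * y ^ 2 + 2 * x * y + 4 * x - 4 := by nlinarith
  have htwo :
      0 < 12 * y ^ 2 + 5 * x ^ 2 + 4 * x * y + 4 * x * y ^ 2 + 4 * x ^ 2 * y + 4 * x - 8 := by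
    nlinarith [mul_nonneg hx (sub_nonneg.mpr hy), sq_nonneg (x - 1 / 2), sq_nonneg (y - 1 / 2),
      mul_nonneg (mul_nonneg hx (sub_nonneg.mpr hy)) hx,
      mul_nonneg (mul_nonneg hx (sub_nonneg.mpr hy)) (sub_nonneg.mpr hy)]
  linarith [mul_nonneg (sub_nonneg.mpr hp) hslope, sq_nonneg ((p - 2) * y)]

section Star

variable {n : ℕ} {Γ : Matrix (PauliMon n 2) (PauliMon n 2) ℝ} {i j : Fin n} {K : Finset (Fin n)}

theorem gval_add_sum_gval_le_one (hΓ : IsMoment Γ) (hij : i ≠ j) (hi : i ∉ K) (hj : j ∉ K) :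
    gval Γ i j + ∑ k ∈ K, gval Γ i k ≤ 1 := by
  rw [← sum_insert hj]
  exact sum_gval_le_one hΓ (by simp [hi, hij])

theorem sum_gval_le_R (hΓ : IsMoment Γ) (hij : i ≠ j) (hi : i ∉ K) (hj : j ∉ K)
    (hnonneg : ∀ k ∈ K, 0 ≤ gval Γ i k) (hg : 1 / 2 ≤ gval Γ i j) (hg' : gval Γ i j ≤ √3 / 2) :
    ∑ k ∈ K, gval Γ i k ≤ R (gval Γ i j) := by
  have hx : 0 ≤ ∑ k ∈ K, gval Γ i k := sum_nonneg hnonneg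
  rcases Nat.lt_or_ge #K 2 with hcard | hcard
  · interval_cases hK : #K
    · rw [card_eq_zero.mp hK, sum_empty]
      exact R_nonneg (by linarith) hg'
    · obtain ⟨k, rfl⟩ := card_eq_one.mp hK
      rw [sum_singleton]
      exact gval_le_R hΓ hij (notMem_singleton.mp hi) (notMem_singleton.mp hj)
  · exact le_R_of_star_inequality (by exact_mod_cast hcard) hx hg
      (add_comm (gval Γ i j) _ ▸ gval_add_sum_gval_le_one hΓ hij hi hj)
      (sum_gval_sq_le hΓ hij hi hj (by positivity))

theorem sum_gval_le_Q (hΓ : IsMoment Γ) (hij : i ≠ j) (hi : i ∉ K) (hj : j ∉ K)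
    (hpos : ∀ k ∈ K, 0 < gval Γ i k) : ∑ k ∈ K, gval Γ i k ≤ Q (pos (gval Γ i j)) := by
  rcases le_or_gt (gval Γ i j) (1 / 2) with hg | hg
  · have hpos_le : pos (gval Γ i j) ≤ 1 / 2 := max_le hg (by norm_num)
    rw [Q, if_pos hpos_le, le_sub_comm]
    exact max_le (by linarith [gval_add_sum_gval_le_one hΓ hij hi hj])
      (sub_nonneg.mpr (sum_gval_le_one hΓ hi))
  rw [pos_of_nonneg (by linarith), Q, if_neg hg.not_ge]
  split_ifs with hg'
  · exact sum_gval_le_R hΓ hij hi hj (fun k hk => (hpos k hk).le) hg.le hg'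
  · refine (sum_eq_zero fun k hk => ?_).le
    have hk' := gval_le_R hΓ hij (ne_of_mem_of_not_mem hk hi).symm
      (ne_of_mem_of_not_mem hk hj).symm
    linarith [hpos k hk, R_nonpos (not_le.mp hg').le]

theorem sum_pos_gval_le_Q (hΓ : IsMoment Γ) (hij : i ≠ j) (hi : i ∉ K) (hj : j ∉ K) :
    ∑ k ∈ K, pos (gval Γ i k) ≤ Q (pos (gval Γ i j)) := by
  have hfilter : ∑ k ∈ K with 0 < gval Γ i k, gval Γ i k = ∑ k ∈ K, pos (gval Γ i k) := by
    rw [sum_filter]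
    refine sum_congr rfl fun k _ => ?_
    split_ifs with h
    · exact (pos_of_nonneg h.le).symm
    · exact (pos_of_nonpos (not_lt.mp h)).symm
  rw [← hfilter]
  exact sum_gval_le_Q hΓ hij (fun h => hi (mem_of_mem_filter _ h))
    (fun h => hj (mem_of_mem_filter _ h)) fun k hk => (mem_filter.mp hk).2

theorem pos_gval_mem_Icc (hΓ : IsMoment Γ) (hij : i ≠ j) : pos (gval Γ i j) ∈ Set.Icc 0 1 :=
  ⟨pos_nonneg _, max_le (abs_le.mp (abs_gval_le_one hΓ hij)).2 zero_le_one⟩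

end Star

/-! ### The angle function and the vertex factors -/

theorem ThetaClass.one_sub_apply_sum_le_prod {Θ : ℝ → ℝ} (hΘ : ThetaClass Θ) {ι : Type*}
    (s : Finset ι) (x : ι → ℝ) (hx : ∀ i ∈ s, 0 ≤ x i) (hs : ∑ i ∈ s, x i ≤ 1) :
    1 - Θ (∑ i ∈ s, x i) ≤ ∏ i ∈ s, (1 - Θ (x i)) := by
  have hsum : ∑ k, x (s.equivFin.symm k) = ∑ i ∈ s, x i := by
    rw [Equiv.sum_comp s.equivFin.symm fun i : s => x i, sum_coe_sort]
  have hprod : ∏ k, (1 - Θ (x (s.equivFin.symm k))) = ∏ i ∈ s, (1 - Θ (x i)) := by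
    rw [Equiv.prod_comp s.equivFin.symm fun i : s => 1 - Θ (x i),
      prod_coe_sort s fun i => 1 - Θ (x i)]
  rw [← hsum, ← hprod]
  refine hΘ.prod_ge _ _ (fun k => ⟨hx _ (s.equivFin.symm k).2, ?_⟩) (hsum.trans_le hs)
  exact (single_le_sum hx (s.equivFin.symm k).2).trans hs

section Nu

variable {β : ℝ} {Θ Λ : ℝ → ℝ} {x : ℝ}

theorem sin_arcsin_sqrt (hx : x ≤ 1) : Real.sin (Real.arcsin √x) = √x :=
  Real.sin_arcsin (by linarith [Real.sqrt_nonneg x]) (Real.sqrt_le_one.mpr hx)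

theorem cos_arcsin_sqrt (hx : 0 ≤ x) : Real.cos (Real.arcsin √x) = √(1 - x) := by
  rw [Real.cos_arcsin, Real.sq_sqrt hx]

theorem sin_nu_nonneg (β : ℝ) (Θ Λ : ℝ → ℝ) (x : ℝ) : 0 ≤ Real.sin (nu β Θ Λ x) :=
  Real.sin_nonneg_of_nonneg_of_le_pi (Real.arcsin_nonneg.mpr (Real.sqrt_nonneg _))
    ((Real.arcsin_le_pi_div_two _).trans (by linarith [Real.pi_pos]))

theorem cos_nu_nonneg (β : ℝ) (Θ Λ : ℝ → ℝ) (x : ℝ) : 0 ≤ Real.cos (nu β Θ Λ x) :=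
  Real.cos_arcsin_nonneg _

theorem sin_nu_of_le (hx : x ≤ β) (hΘ : Θ (pos x) ≤ 1) :
    Real.sin (nu β Θ Λ x) = √(Θ (pos x)) := by
  rw [nu, if_pos hx, sin_arcsin_sqrt hΘ]

theorem sin_nu_of_lt (hx : β < x) (hΛ : Λ (pos x) ≤ 1) :
    Real.sin (nu β Θ Λ x) = √(Λ (pos x)) := by
  rw [nu, if_neg hx.not_ge, sin_arcsin_sqrt hΛ]

theorem cos_nu_of_le (hx : x ≤ β) (hΘ : 0 ≤ Θ (pos x)) :
    Real.cos (nu β Θ Λ x) = √(1 - Θ (pos x)) := by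
  rw [nu, if_pos hx, cos_arcsin_sqrt hΘ]

theorem cos_nu_of_lt (hx : β < x) (hΛ : 0 ≤ Λ (pos x)) :
    Real.cos (nu β Θ Λ x) = √(1 - Λ (pos x)) := by
  rw [nu, if_neg hx.not_ge, cos_arcsin_sqrt hΛ]

end Nu

section Acoef

variable {n : ℕ} {G : SimpleGraph (Fin n)} {Γ : Matrix (PauliMon n 2) (PauliMon n 2) ℝ}
  {β : ℝ} {Θ Λ : ℝ → ℝ} {i j k : Fin n} {K : Finset (Fin n)}

theorem sqrt_one_sub_le_prod_cos_nu (hΓ : IsMoment Γ) (hΘ : ThetaClass Θ) (hi : i ∉ K)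
    (hK : ∀ k ∈ K, gval Γ i k ≤ β) {q : ℝ} (hq : ∑ k ∈ K, pos (gval Γ i k) ≤ q) (hq1 : q ≤ 1) :
    √(1 - Θ q) ≤ ∏ k ∈ K, Real.cos (nu β Θ Λ (gval Γ i k)) := by
  have hnonneg : 0 ≤ ∑ k ∈ K, pos (gval Γ i k) := sum_nonneg fun _ _ => pos_nonneg _
  have hmem : ∀ k ∈ K, Θ (pos (gval Γ i k)) ∈ Set.Icc 0 1 := fun k hk =>
    hΘ.mapsTo (pos_gval_mem_Icc hΓ (ne_of_mem_of_not_mem hk hi).symm)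
  rw [prod_congr rfl fun k hk => cos_nu_of_le (hK k hk) (hmem k hk).1,
    ← Real.sqrt_prod _ fun k hk => sub_nonneg.mpr (hmem k hk).2]
  gcongr
  calc 1 - Θ q ≤ 1 - Θ (∑ k ∈ K, pos (gval Γ i k)) :=
        sub_le_sub_left (hΘ.mono ⟨hnonneg, hq.trans hq1⟩ ⟨hnonneg.trans hq, hq1⟩ hq) 1
    _ ≤ ∏ k ∈ K, (1 - Θ (pos (gval Γ i k))) :=
        hΘ.one_sub_apply_sum_le_prod K _ (fun k _ => pos_nonneg _) (hq.trans hq1)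

theorem sqrt_one_sub_le_Acoef (hΓ : IsMoment Γ) (hΘ : ThetaClass Θ) (hij : i ≠ j)
    (h : ∀ k, G.Adj i k → k ≠ j → gval Γ i k ≤ β) :
    √(1 - Θ (Q (pos (gval Γ i j)))) ≤ Acoef (nu β Θ Λ) G Γ i j :=
  sqrt_one_sub_le_prod_cos_nu hΓ hΘ (by simp) (by simpa using h)
    (sum_pos_gval_le_Q hΓ hij (by simp) (by simp)) (Q_le_one (pos_nonneg _))

theorem f_le_Acoef (hΓ : IsMoment Γ) (hΘ : ThetaClass Θ)
    (hΛ : Set.MapsTo Λ (Set.Icc 0 1) (Set.Icc 0 1)) (hβ : 1 / 2 ≤ β) (hij : i ≠ j)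
    (hik : G.Adj i k) (hkj : k ≠ j) (hk : β < gval Γ i k) :
    f Θ Λ (gval Γ i j) (gval Γ i k) ≤ Acoef (nu β Θ Λ) G Γ i j := by
  classical
  have hΛk := hΛ (pos_gval_mem_Icc hΓ hik.ne)
  unfold Acoef
  set N := univ.filter fun l => G.Adj i l ∧ l ≠ j with hN
  have hsum : pos (gval Γ i j) + ∑ l ∈ N.erase k, pos (gval Γ i l) ≤ Q (pos (gval Γ i k)) := by
    rw [← sum_insert (f := fun l => pos (gval Γ i l)) (by simp [hN])]
    exact sum_pos_gval_le_Q hΓ hik.ne (by simp [hij, hN]) (by simp [hkj])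
  have hkN : k ∈ N := by simp [hN, hik, hkj]
  rw [f, Real.sqrt_mul (sub_nonneg.mpr hΛk.2), ← mul_prod_erase N _ hkN, cos_nu_of_lt hk hΛk.1]
  gcongr
  refine sqrt_one_sub_le_prod_cos_nu hΓ hΘ (by simp [hN]) (fun l hl => ?_) (by linarith)
    (by linarith [Q_le_one (pos_nonneg (gval Γ i k)), pos_nonneg (gval Γ i j)])
  obtain ⟨hlk, hil, -⟩ : l ≠ k ∧ G.Adj i l ∧ l ≠ j := by simpa [hN] using hl
  calc gval Γ i l ≤ R (gval Γ i k) := gval_le_R hΓ hik.ne hil.ne hlk.symm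
    _ ≤ 1 / 2 := R_le_one_half (hβ.trans hk.le)
    _ ≤ β := hβ

theorem gval_le_R_of_lt (hΓ : IsMoment Γ) (hβ : 0 ≤ β) (hij : i ≠ j) (hik : i ≠ k) (hkj : k ≠ j)
    (hk : β < gval Γ i k) : gval Γ i j ≤ R β :=
  (gval_le_R hΓ hik hij hkj).trans (antitoneOn_R hβ (hβ.trans hk.le) hk.le)

theorem fStar_le_Acoef (hΓ : IsMoment Γ) (hΘ : ThetaClass Θ) (hΛ : LambdaClass Θ β Λ)
    (hβ : 1 / 2 ≤ β) (hij : i ≠ j) (hik : G.Adj i k) (hkj : k ≠ j) (hk : β < gval Γ i k) :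
    fStar Θ Λ (gval Γ i j) ≤ Acoef (nu β Θ Λ) G Γ i j :=
  calc fStar Θ Λ (gval Γ i j) ≤ f Θ Λ (gval Γ i j) (gval Γ i k) :=
        hΛ.fStar_le _ _ (abs_le.mp (abs_gval_le_one hΓ hij)).1
          (gval_le_R_of_lt hΓ (by linarith) hij hik.ne hkj hk) hk.le
          (gval_le_R hΓ hij hik.ne hkj.symm)
    _ ≤ Acoef (nu β Θ Λ) G Γ i j := f_le_Acoef hΓ hΘ hΛ.mapsTo hβ hij hik hkj hk

end Acoef

/-! ### The bound on a single edge -/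

section EdgeBound

variable {β g A B : ℝ} {Θ Λ : ℝ → ℝ}

theorem fStar_nonneg (Θ Λ : ℝ → ℝ) (x : ℝ) : 0 ≤ fStar Θ Λ x := Real.sqrt_nonneg _

theorem Q_mem_Icc {x : ℝ} (hx : 0 ≤ x) (hx' : x ≤ 1) : Q x ∈ Set.Icc (0 : ℝ) 1 := by
  refine ⟨?_, Q_le_one hx⟩
  unfold Q
  split_ifs with _ h
  · linarith
  · exact R_nonneg hx h
  · exact le_rfl

theorem mul_le_of_le_sInf_div {b : ℝ} {α : Type*} {s : Set α} {N D : α → ℝ}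
    (hb : b ≤ sInf ((fun x => N x / D x) '' s)) (hN : ∀ x ∈ s, 0 ≤ N x) (hD : ∀ x ∈ s, 0 < D x)
    {x : α} (hx : x ∈ s) : b * D x ≤ N x := by
  have hbdd : BddBelow ((fun x => N x / D x) '' s) :=
    ⟨0, Set.forall_mem_image.mpr fun y hy => div_nonneg (hN y hy) (hD y hy).le⟩
  exact (le_div_iff₀ (hD x hx)).mp (hb.trans (csInf_le hbdd ⟨x, hx, rfl⟩))

theorem one_sub_apply_Q_nonneg (hΘ : Set.MapsTo Θ (Set.Icc 0 1) (Set.Icc 0 1)) (hg : g ≤ 1) :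
    0 ≤ 1 - Θ (Q (pos g)) :=
  sub_nonneg.mpr (hΘ (Q_mem_Icc (pos_nonneg g) (max_le hg zero_le_one))).2

theorem one_add_sq_add_mul_le {t s : ℝ} (ht : 0 ≤ t) (hs : 0 ≤ s) (hA : t ≤ A) (hB : t ≤ B) :
    1 + t ^ 2 + 2 * s * t ≤ 1 + A * B + (A + B) * s := by
  linarith [mul_le_mul hA hB ht (ht.trans hA), mul_le_mul_of_nonneg_left hA hs,
    mul_le_mul_of_nonneg_left hB hs]

theorem two_sub_add_sqrt_le {s : ℝ} (hΘ : Set.MapsTo Θ (Set.Icc 0 1) (Set.Icc 0 1))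
    (hg : g ≤ 1) (hs : 0 ≤ s) (hA : √(1 - Θ (Q (pos g))) ≤ A) (hB : √(1 - Θ (Q (pos g))) ≤ B) :
    2 - Θ (Q (pos g)) + 2 * √(s * (1 - Θ (Q (pos g)))) ≤ 1 + A * B + (A + B) * √s := by
  refine le_trans (le_of_eq ?_) (one_add_sq_add_mul_le (Real.sqrt_nonneg _) (Real.sqrt_nonneg s)
    hA hB)
  rw [Real.sq_sqrt (one_sub_apply_Q_nonneg hΘ hg), Real.sqrt_mul hs]
  ring

theorem minBound_mul_le_of_mem_Icc_zero (hΘ : Set.MapsTo Θ (Set.Icc 0 1) (Set.Icc 0 1))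
    (hβ' : β ≤ 1) (hg : g ∈ Set.Icc 0 β) :
    minBound β Θ Λ * (2 * (1 + g)) ≤
      2 - Θ (Q (pos g)) + 2 * √(Θ (pos g) * (1 - Θ (Q (pos g)))) :=
  mul_le_of_le_sInf_div (min_le_left _ _)
    (fun x hx => by
      linarith [one_sub_apply_Q_nonneg hΘ (hx.2.trans hβ'),
        Real.sqrt_nonneg (Θ (pos x) * (1 - Θ (Q (pos x))))])
    (fun x hx => by linarith [hx.1]) hg

/-- `r₁` governs the negative values of `g` as well: there the right-hand side does not depend on
`g`, so it suffices to compare with `g = 0`. -/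
theorem minBound_mul_le_of_sqrt_le (hΘ : ThetaClass Θ) (hβ : 0 ≤ β) (hβ' : β ≤ 1) (hg : -1 ≤ g)
    (hg' : g ≤ β) (hA : √(1 - Θ (Q (pos g))) ≤ A) (hB : √(1 - Θ (Q (pos g))) ≤ B) :
    minBound β Θ Λ * (2 * (1 + g)) ≤ 1 + A * B + (A + B) * √(Θ (pos g)) := by
  have hpos := hΘ.mapsTo ⟨pos_nonneg g, max_le (hg'.trans hβ') zero_le_one⟩
  refine le_trans ?_ (two_sub_add_sqrt_le hΘ.mapsTo (hg'.trans hβ') hpos.1 hA hB)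
  rcases le_total 0 g with h0 | h0
  · exact minBound_mul_le_of_mem_Icc_zero hΘ.mapsTo hβ' ⟨h0, hg'⟩
  have hzero := minBound_mul_le_of_mem_Icc_zero (Λ := Λ) hΘ.mapsTo hβ' ⟨le_rfl, hβ⟩
  have hnonneg := one_sub_apply_Q_nonneg hΘ.mapsTo (hg'.trans hβ')
  rw [pos_of_nonpos le_rfl] at hzero
  rw [pos_of_nonpos h0] at hnonneg ⊢
  rw [hΘ.zero, zero_mul, Real.sqrt_zero] at hzero ⊢
  nlinarith

theorem minBound_mul_le_of_sqrt_le_of_le (hΘ : Set.MapsTo Θ (Set.Icc 0 1) (Set.Icc 0 1))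
    (hΛ : Set.MapsTo Λ (Set.Icc 0 1) (Set.Icc 0 1)) (hβ : 0 ≤ β) (hg : g ∈ Set.Icc β 1)
    (hA : √(1 - Θ (Q (pos g))) ≤ A) (hB : √(1 - Θ (Q (pos g))) ≤ B) :
    minBound β Θ Λ * (2 * (1 + g)) ≤ 1 + A * B + (A + B) * √(Λ (pos g)) := by
  have hpos := hΛ ⟨pos_nonneg g, max_le hg.2 zero_le_one⟩
  refine le_trans ?_ (two_sub_add_sqrt_le hΘ hg.2 hpos.1 hA hB)
  exact mul_le_of_le_sInf_div ((min_le_right _ _).trans (min_le_left _ _))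
    (fun x hx => by
      linarith [one_sub_apply_Q_nonneg hΘ hx.2,
        Real.sqrt_nonneg (Λ (pos x) * (1 - Θ (Q (pos x))))])
    (fun x hx => by linarith [hx.1]) hg

theorem minBound_mul_le_of_fStar_le (hg : -1 ≤ g) (hg' : g ≤ R β) (hA : fStar Θ Λ g ≤ A)
    (hB : fStar Θ Λ g ≤ B) :
    minBound β Θ Λ * (2 * (1 + g)) ≤ 1 + A * B + (A + B) * √(Θ (pos g)) := by
  have hf := fStar_nonneg Θ Λ
  refine le_trans ?_ (one_add_sq_add_mul_le (hf g) (Real.sqrt_nonneg _) hA hB)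
  rcases hg.eq_or_lt with rfl | hg
  · have := hf (-1)
    simp only [add_neg_cancel, mul_zero]
    positivity
  · exact mul_le_of_le_sInf_div ((min_le_right _ _).trans (min_le_right _ _))
      (fun x _ => by have := hf x; positivity) (fun x hx => by linarith [hx.1]) ⟨hg, hg'⟩

variable {n : ℕ} {G : SimpleGraph (Fin n)} {Γ : Matrix (PauliMon n 2) (PauliMon n 2) ℝ}
  {i j : Fin n}

theorem sqrt_one_sub_le_Acoef_or_fStar_le_Acoef (hΓ : IsMoment Γ) (hΘ : ThetaClass Θ)
    (hΛ : LambdaClass Θ β Λ) (hβ : 1 / 2 ≤ β) (hij : i ≠ j) :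
    √(1 - Θ (Q (pos (gval Γ i j)))) ≤ Acoef (nu β Θ Λ) G Γ i j ∨
      gval Γ i j ≤ R β ∧ fStar Θ Λ (gval Γ i j) ≤ Acoef (nu β Θ Λ) G Γ i j := by
  by_cases h : ∀ k, G.Adj i k → k ≠ j → gval Γ i k ≤ β
  · exact .inl (sqrt_one_sub_le_Acoef hΓ hΘ hij h)
  · push Not at h
    obtain ⟨k, hik, hkj, hk⟩ := h
    exact .inr ⟨gval_le_R_of_lt hΓ (by linarith) hij hik.ne hkj hk,
      fStar_le_Acoef hΓ hΘ hΛ hβ hij hik hkj hk⟩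

theorem sqrt_one_sub_le_Acoef_of_lt (hΓ : IsMoment Γ) (hΘ : ThetaClass Θ) (hβ : 1 / 2 ≤ β)
    (hij : i ≠ j) (hg : β < gval Γ i j) :
    √(1 - Θ (Q (pos (gval Γ i j)))) ≤ Acoef (nu β Θ Λ) G Γ i j :=
  sqrt_one_sub_le_Acoef hΓ hΘ hij fun _ hik hkj =>
    calc gval Γ i _ ≤ R (gval Γ i j) := gval_le_R hΓ hij hik.ne hkj.symm
      _ ≤ 1 / 2 := R_le_one_half (hβ.trans hg.le)
      _ ≤ β := hβ

theorem minBound_mul_le_edge (hΓ : IsMoment Γ) (hΘ : ThetaClass Θ) (hΛ : LambdaClass Θ β Λ)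
    (hβ : 1 / 2 ≤ β) (hβ' : β ≤ 1) (hij : i ≠ j) :
    minBound β Θ Λ * (2 * (1 + gval Γ i j)) ≤
      1 + Acoef (nu β Θ Λ) G Γ i j * Acoef (nu β Θ Λ) G Γ j i +
        (Acoef (nu β Θ Λ) G Γ i j + Acoef (nu β Θ Λ) G Γ j i) *
          Real.sin (nu β Θ Λ (gval Γ i j)) := by
  obtain ⟨hg, hg'⟩ := abs_le.mp (abs_gval_le_one hΓ hij)
  have hpos := pos_gval_mem_Icc hΓ hij
  have hβ0 : 0 ≤ β := by linarith
  rcases lt_or_ge β (gval Γ i j) with hβg | hgβ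
  · rw [sin_nu_of_lt hβg (hΛ.mapsTo hpos).2]
    exact minBound_mul_le_of_sqrt_le_of_le hΘ.mapsTo hΛ.mapsTo hβ0 ⟨hβg.le, hg'⟩
      (sqrt_one_sub_le_Acoef_of_lt hΓ hΘ hβ hij hβg)
      (gval_comm Γ i j ▸ sqrt_one_sub_le_Acoef_of_lt hΓ hΘ hβ hij.symm (gval_comm Γ i j ▸ hβg))
  rw [sin_nu_of_le hgβ (hΘ.mapsTo hpos).2]
  have hi := sqrt_one_sub_le_Acoef_or_fStar_le_Acoef (G := G) hΓ hΘ hΛ hβ hij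
  have hj := sqrt_one_sub_le_Acoef_or_fStar_le_Acoef (G := G) hΓ hΘ hΛ hβ hij.symm
  rw [gval_comm Γ j i] at hj
  rcases hi, hj with ⟨hi | ⟨hR, hi⟩, hj | ⟨hR, hj⟩⟩
  · exact minBound_mul_le_of_sqrt_le hΘ hβ0 hβ' hg hgβ hi hj
  · rcases le_total (√(1 - Θ (Q (pos (gval Γ i j))))) (fStar Θ Λ (gval Γ i j)) with h | h
    · exact minBound_mul_le_of_sqrt_le hΘ hβ0 hβ' hg hgβ hi (h.trans hj)
    · exact minBound_mul_le_of_fStar_le hg hR (h.trans hi) hj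
  · rcases le_total (√(1 - Θ (Q (pos (gval Γ i j))))) (fStar Θ Λ (gval Γ i j)) with h | h
    · exact minBound_mul_le_of_sqrt_le hΘ hβ0 hβ' hg hgβ (h.trans hi) hj
    · exact minBound_mul_le_of_fStar_le hg hR hi (h.trans hj)
  · exact minBound_mul_le_of_fStar_le hg hR hi hj

end EdgeBound

/-! ### The common eigenbasis of the gates -/

section TensorVec

variable {n : ℕ}

/-- The product vector `v₁ ⊗ ⋯ ⊗ vₙ`. -/
def tensorVec (v : Fin n → Fin 2 → ℂ) : (Fin n → Fin 2) → ℂ := fun t => ∏ k, v k (t k)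

theorem tensorOp_mulVec_tensorVec (A : Fin n → Matrix (Fin 2) (Fin 2) ℂ) (v : Fin n → Fin 2 → ℂ) :
    tensorOp A *ᵥ tensorVec v = tensorVec fun k => A k *ᵥ v k := by
  ext s
  simp only [tensorOp, tensorVec, mulVec, dotProduct, of_apply, prod_univ_sum,
    Fintype.piFinset_univ, prod_mul_distrib]

theorem star_tensorVec_dotProduct_tensorVec (v w : Fin n → Fin 2 → ℂ) :
    star (tensorVec v) ⬝ᵥ tensorVec w = ∏ k, star (v k) ⬝ᵥ w k := by
  simp only [tensorVec, dotProduct, Pi.star_apply, prod_univ_sum, Fintype.piFinset_univ,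
    star_prod, prod_mul_distrib]

theorem tensorVec_update_apply (v : Fin n → Fin 2 → ℂ) (i : Fin n) (a : Fin 2 → ℂ)
    (t : Fin n → Fin 2) :
    tensorVec (Function.update v i a) t = a (t i) * ∏ k ∈ univ.erase i, v k (t k) := by
  rw [tensorVec, ← mul_prod_erase univ _ (mem_univ i), Function.update_self]
  congr 1
  exact prod_congr rfl fun k hk => by rw [Function.update_of_ne (ne_of_mem_erase hk)]

theorem tensorVec_update_add (v : Fin n → Fin 2 → ℂ) (i : Fin n) (a b : Fin 2 → ℂ) :
    tensorVec (Function.update v i (a + b)) =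
      tensorVec (Function.update v i a) + tensorVec (Function.update v i b) := by
  ext t
  simp only [Pi.add_apply, tensorVec_update_apply, add_mul]

theorem tensorVec_update_smul (v : Fin n → Fin 2 → ℂ) (i : Fin n) (c : ℂ) (a : Fin 2 → ℂ) :
    tensorVec (Function.update v i (c • a)) = c • tensorVec (Function.update v i a) := by
  ext t
  simp only [Pi.smul_apply, tensorVec_update_apply, smul_eq_mul, mul_assoc]

theorem site_mulVec_tensorVec (σ : Pauli) (i : Fin n) (v : Fin n → Fin 2 → ℂ) :
    site σ i *ᵥ tensorVec v = tensorVec (Function.update v i (σ.mat *ᵥ v i)) := by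
  rw [site, tensorOp_mulVec_tensorVec]
  congr 1
  ext k : 1
  obtain rfl | hk := eq_or_ne k i
  · simp
  · simp [hk]

theorem site_add_site_mulVec_tensorVec (σ τ : Pauli) (i : Fin n) (v : Fin n → Fin 2 → ℂ) :
    (site σ i + site τ i) *ᵥ tensorVec v =
      tensorVec (Function.update v i ((σ.mat + τ.mat) *ᵥ v i)) := by
  rw [add_mulVec, add_mulVec, tensorVec_update_add, site_mulVec_tensorVec, site_mulVec_tensorVec]

theorem xMinusY_mulVec_tensorVec (i : Fin n) (v : Fin n → Fin 2 → ℂ) :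
    xMinusY i *ᵥ tensorVec v =
      tensorVec (Function.update v i ((Pauli.X.mat - Pauli.Y.mat) *ᵥ v i)) := by
  rw [xMinusY, sub_mulVec, sub_mulVec, sub_eq_add_neg, sub_eq_add_neg, tensorVec_update_add,
    ← neg_one_smul ℂ (Pauli.Y.mat *ᵥ v i), tensorVec_update_smul, neg_one_smul,
    site_mulVec_tensorVec, site_mulVec_tensorVec]

end TensorVec

section SignQubit

theorem ofReal_sqrt_two_mul_self : ((√2 : ℝ) : ℂ) * (√2 : ℝ) = 2 := by
  exact_mod_cast Real.mul_self_sqrt zero_le_two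

theorem sign_mul_self (u : ℤˣ) : (u : ℂ) * u = 1 := by
  rcases Int.units_eq_one_or u with rfl | rfl <;> simp

/-- The unit eigenvector of `X - Y` with eigenvalue `±√2`, indexed by the sign of the eigenvalue. -/
def signQubit (u : ℤˣ) : Fin 2 → ℂ := ![(√2 : ℝ) / 2, u * (1 - Complex.I) / 2]

theorem star_signQubit_dotProduct_signQubit (u v : ℤˣ) :
    star (signQubit u) ⬝ᵥ signQubit v = if u = v then 1 else 0 := by
  have h : star (signQubit u) ⬝ᵥ signQubit v = (1 + u * v) / 2 := by
    simp only [signQubit, dotProduct, Fin.sum_univ_two, Pi.star_apply, cons_val_zero, cons_val_one,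
      Complex.star_def, map_div₀, map_mul, map_sub, map_one, Complex.conj_ofReal, Complex.conj_I,
      map_ofNat, map_intCast]
    linear_combination ofReal_sqrt_two_mul_self / 4 - u * v / 4 * Complex.I_sq
  rw [h]
  rcases Int.units_eq_one_or u with rfl | rfl <;> rcases Int.units_eq_one_or v with rfl | rfl <;>
    norm_num

theorem X_sub_Y_mulVec (v : Fin 2 → ℂ) :
    (Pauli.X.mat - Pauli.Y.mat) *ᵥ v = ![(1 + Complex.I) * v 1, (1 - Complex.I) * v 0] := by
  ext t
  fin_cases t <;> simp [Pauli.mat, Matrix.mulVec, dotProduct]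

theorem X_add_Y_mulVec (v : Fin 2 → ℂ) :
    (Pauli.X.mat + Pauli.Y.mat) *ᵥ v = ![(1 - Complex.I) * v 1, (1 + Complex.I) * v 0] := by
  ext t
  fin_cases t <;> simp [Pauli.mat, Matrix.mulVec, dotProduct, sub_eq_add_neg]

theorem X_sub_Y_mulVec_signQubit (u : ℤˣ) :
    (Pauli.X.mat - Pauli.Y.mat) *ᵥ signQubit u = ((√2 : ℝ) * u : ℂ) • signQubit u := by
  rw [X_sub_Y_mulVec]
  ext t
  fin_cases t
  · change (1 + Complex.I) * (u * (1 - Complex.I) / 2) = (√2 : ℝ) * u * ((√2 : ℝ) / 2)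
    linear_combination (-u / 2 : ℂ) * ofReal_sqrt_two_mul_self - u / 2 * Complex.I_sq
  · change (1 - Complex.I) * ((√2 : ℝ) / 2) = (√2 : ℝ) * u * (u * (1 - Complex.I) / 2)
    linear_combination (-(√2 : ℝ) * (1 - Complex.I) / 2 : ℂ) * sign_mul_self u

theorem X_add_Y_mulVec_signQubit (u : ℤˣ) :
    (Pauli.X.mat + Pauli.Y.mat) *ᵥ signQubit u =
      (-Complex.I * (√2 : ℝ) * u : ℂ) • signQubit (-u) := by
  have hneg : (((-u : ℤˣ) : ℤ) : ℂ) = -u := by push_cast; rfl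
  rw [X_add_Y_mulVec]
  ext t
  fin_cases t
  · change (1 - Complex.I) * (u * (1 - Complex.I) / 2) =
      -Complex.I * (√2 : ℝ) * u * ((√2 : ℝ) / 2)
    linear_combination (Complex.I * u / 2 : ℂ) * ofReal_sqrt_two_mul_self + u / 2 * Complex.I_sq
  · change (1 + Complex.I) * ((√2 : ℝ) / 2) =
      -Complex.I * (√2 : ℝ) * u * (((-u : ℤˣ) : ℤ) * (1 - Complex.I) / 2)
    linear_combination (Complex.I * (√2 : ℝ) * u * (1 - Complex.I) / 2 : ℂ) * hneg -
      ((√2 : ℝ) / 2 : ℂ) * (Complex.I * (1 - Complex.I) * sign_mul_self u - Complex.I_sq)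

theorem Z_mulVec_signQubit (u : ℤˣ) : Pauli.Z.mat *ᵥ signQubit u = signQubit (-u) := by
  ext t
  fin_cases t <;> simp [Pauli.mat, signQubit, Matrix.mulVec, dotProduct, neg_div]

theorem sum_signQubit : ∑ u, signQubit u = Pi.single 0 ((√2 : ℝ) : ℂ) := by
  ext t
  fin_cases t <;> simp [signQubit, UnitsInt.univ] <;> ring

end SignQubit

section SignVec

variable {n : ℕ}

/-- The joint eigenvectors of the operators `X_i - Y_i`, indexed by the signs of the eigenvalues. -/
def signVec (s : Fin n → ℤˣ) : (Fin n → Fin 2) → ℂ := tensorVec fun k => signQubit (s k)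

/-- The sign pattern `s` with the signs in `T` reversed. -/
def flipSigns (T : Finset (Fin n)) (s : Fin n → ℤˣ) : Fin n → ℤˣ :=
  fun k => if k ∈ T then -s k else s k

theorem update_neg_eq_flipSigns (i : Fin n) (s : Fin n → ℤˣ) :
    Function.update s i (-s i) = flipSigns {i} s := by
  ext k : 1
  obtain rfl | hk := eq_or_ne k i
  · simp [flipSigns]
  · simp [flipSigns, hk]

theorem flipSigns_apply_of_mem {T : Finset (Fin n)} {k : Fin n} (hk : k ∈ T) (s : Fin n → ℤˣ) :
    flipSigns T s k = -s k := if_pos hk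

theorem flipSigns_apply_of_notMem {T : Finset (Fin n)} {k : Fin n} (hk : k ∉ T) (s : Fin n → ℤˣ) :
    flipSigns T s k = s k := if_neg hk

theorem flipSigns_flipSigns_self (T : Finset (Fin n)) (s : Fin n → ℤˣ) :
    flipSigns T (flipSigns T s) = s := by
  ext k : 1
  by_cases hk : k ∈ T <;> simp [flipSigns, hk]

theorem flipSigns_flipSigns {S T : Finset (Fin n)} (h : Disjoint S T) (s : Fin n → ℤˣ) :
    flipSigns S (flipSigns T s) = flipSigns (S ∪ T) s := by
  ext k : 1
  by_cases hS : k ∈ S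
  · simp [flipSigns, hS, Finset.disjoint_left.mp h hS]
  · simp [flipSigns, hS]

theorem star_signVec_dotProduct_signVec (s t : Fin n → ℤˣ) :
    star (signVec s) ⬝ᵥ signVec t = if s = t then 1 else 0 := by
  simp only [signVec, star_tensorVec_dotProduct_tensorVec, star_signQubit_dotProduct_signQubit,
    prod_ite_zero, mem_univ, true_imp_iff, prod_const_one, funext_iff]

theorem tensorVec_update_signQubit (s : Fin n → ℤˣ) (i : Fin n) (u : ℤˣ) :
    tensorVec (Function.update (fun k => signQubit (s k)) i (signQubit u)) =
      signVec (Function.update s i u) :=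
  congrArg tensorVec (Function.comp_update signQubit s i u).symm

theorem xMinusY_mulVec_signVec (i : Fin n) (s : Fin n → ℤˣ) :
    xMinusY i *ᵥ signVec s = ((√2 : ℝ) * s i : ℂ) • signVec s := by
  rw [signVec, xMinusY_mulVec_tensorVec, X_sub_Y_mulVec_signQubit, tensorVec_update_smul,
    tensorVec_update_signQubit, Function.update_eq_self, signVec]

theorem X_add_Y_mulVec_signVec (i : Fin n) (s : Fin n → ℤˣ) :
    (site .X i + site .Y i) *ᵥ signVec s =
      (-Complex.I * (√2 : ℝ) * s i : ℂ) • signVec (flipSigns {i} s) := by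
  rw [signVec, site_add_site_mulVec_tensorVec, X_add_Y_mulVec_signQubit, tensorVec_update_smul,
    tensorVec_update_signQubit, update_neg_eq_flipSigns]

theorem Z_mulVec_signVec (i : Fin n) (s : Fin n → ℤˣ) :
    site .Z i *ᵥ signVec s = signVec (flipSigns {i} s) := by
  rw [signVec, site_mulVec_tensorVec, Z_mulVec_signQubit, tensorVec_update_signQubit,
    update_neg_eq_flipSigns]

theorem sum_signVec : ∑ s : Fin n → ℤˣ, signVec s = ((√2 : ℝ) : ℂ) ^ n • zeroState n := by
  have hprod : ∑ s : Fin n → ℤˣ, signVec s = tensorVec fun _ => ∑ u, signQubit u := by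
    ext t
    simp only [Finset.sum_apply, signVec, tensorVec, prod_univ_sum, Fintype.piFinset_univ]
  ext t
  rw [hprod, sum_signQubit]
  simp only [tensorVec, Pi.single_apply, prod_ite_zero, mem_univ, true_imp_iff, prod_const,
    card_univ, Fintype.card_fin, zeroState, Pi.smul_apply, smul_eq_mul, mul_ite, mul_one, mul_zero,
    funext_iff, Pi.zero_apply]

end SignVec

/-! ### The output state in the eigenbasis -/

theorem star_sum_smul_dotProduct_mulVec_sum_smul {ι m R : Type*} [Fintype ι] [DecidableEq ι]
    [Fintype m] [CommSemiring R] [StarRing R] {b : ι → m → R}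
    (hb : ∀ s t, star (b s) ⬝ᵥ b t = if s = t then 1 else 0) {A : Matrix m m R} {π : ι → ι}
    {c : ι → R} (hA : ∀ s, A *ᵥ b s = c s • b (π s)) (a : ι → R) :
    star (∑ s, a s • b s) ⬝ᵥ A *ᵥ ∑ s, a s • b s = ∑ s, star (a (π s)) * a s * c s := by
  simp only [mulVec_sum, mulVec_smul, hA, star_sum, star_smul, sum_dotProduct, dotProduct_sum,
    smul_dotProduct, dotProduct_smul, hb, smul_eq_mul]
  refine sum_congr rfl fun s _ => ?_
  simp only [mul_ite, mul_one, mul_zero, sum_ite_eq', mem_univ, if_true]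
  ring

open scoped Matrix.Norms.Operator in
theorem exp_mulVec {m : Type*} [Fintype m] [DecidableEq m] {A : Matrix m m ℂ} {v : m → ℂ} {μ : ℂ}
    (h : A *ᵥ v = μ • v) : NormedSpace.exp A *ᵥ v = Complex.exp μ • v := by
  have hpow : ∀ k : ℕ, A ^ k *ᵥ v = μ ^ k • v := fun k => by
    induction k with
    | zero => simp
    | succ k ih => rw [pow_succ, ← mulVec_mulVec, h, mulVec_smul, ih, smul_smul, pow_succ']
  have hA := (NormedSpace.exp_series_hasSum_exp' (𝕂 := ℂ) A).map
    ((mulVecBilin ℂ ℂ).flip v) (continuous_id.matrix_mulVec continuous_const)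
  have hμ := (NormedSpace.exp_series_hasSum_exp' (𝕂 := ℂ) μ).smul_const v
  rw [Complex.exp_eq_exp_ℂ]
  refine hA.unique (hμ.congr_fun fun k => ?_)
  simp [hpow, smul_smul]

section SignAverage

variable {n : ℕ} {M : Type*} [AddCommMonoid M] [Module ℚ≥0 M]

theorem expect_flipSigns (T : Finset (Fin n)) (F : (Fin n → ℤˣ) → M) :
    𝔼 s, F (flipSigns T s) = 𝔼 s, F s :=
  Fintype.expect_equiv (Function.Involutive.toPerm (flipSigns T) (flipSigns_flipSigns_self T)) _ _
    fun _ => rfl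

theorem expect_eq_expect_of_add_flipSigns {T : Finset (Fin n)} {F F' : (Fin n → ℤˣ) → ℂ}
    (h : ∀ s, F s + F (flipSigns T s) = 2 * F' s) : 𝔼 s, F s = 𝔼 s, F' s := by
  have h2 : 𝔼 s, F s + 𝔼 s, F (flipSigns T s) = 2 * 𝔼 s, F' s := by
    rw [← Finset.expect_add_distrib, Finset.mul_expect]
    exact Finset.expect_congr rfl fun s _ => h s
  rw [expect_flipSigns] at h2
  linear_combination h2 / 2

theorem expect_eq_of_add_flipSigns {T : Finset (Fin n)} {F : (Fin n → ℤˣ) → ℂ} {c : ℂ}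
    (h : ∀ s, F s + F (flipSigns T s) = 2 * c) : 𝔼 s, F s = c := by
  rw [expect_eq_expect_of_add_flipSigns h, Fintype.expect_const]

theorem exp_sign_mul_I_add_exp_neg (x : ℝ) (u : ℤˣ) :
    Complex.exp ((x * u : ℝ) * Complex.I) + Complex.exp (((x * (-u : ℤˣ) : ℝ) : ℂ) * Complex.I) =
      2 * Real.cos x := by
  rw [Complex.ofReal_cos, Complex.two_cos]
  rcases Int.units_eq_one_or u with rfl | rfl
  · simp
  · simp [add_comm]

theorem expect_mul_exp_sum {U : Finset (Fin n)} {F : (Fin n → ℤˣ) → ℂ}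
    {x : (Fin n → ℤˣ) → Fin n → ℝ} (hF : ∀ l ∈ U, ∀ s, F (flipSigns {l} s) = F s)
    (hx : ∀ l ∈ U, ∀ s, x (flipSigns {l} s) = x s) :
    𝔼 s, F s * Complex.exp ((∑ l ∈ U, x s l * s l : ℝ) * Complex.I) =
      𝔼 s, F s * ∏ l ∈ U, (Real.cos (x s l) : ℂ) := by
  induction U using Finset.induction_on generalizing F with
  | empty => simp
  | insert l U hl ih =>
    have hFU : ∀ m ∈ U, ∀ s,
        F (flipSigns {m} s) *
            Complex.exp ((x (flipSigns {m} s) l * flipSigns {m} s l : ℝ) * Complex.I) =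
          F s * Complex.exp ((x s l * s l : ℝ) * Complex.I) := fun m hm s => by
      have hlm : l ∉ ({m} : Finset (Fin n)) := by
        rw [mem_singleton]
        exact fun h => hl (h ▸ hm)
      rw [hF m (mem_insert_of_mem hm), hx m (mem_insert_of_mem hm),
        flipSigns_apply_of_notMem hlm]
    calc 𝔼 s, F s * Complex.exp ((∑ k ∈ insert l U, x s k * s k : ℝ) * Complex.I)
      _ = 𝔼 s, F s * Complex.exp ((x s l * s l : ℝ) * Complex.I) *
            Complex.exp ((∑ k ∈ U, x s k * s k : ℝ) * Complex.I) := by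
          refine expect_congr rfl fun s _ => ?_
          rw [sum_insert hl, Complex.ofReal_add, add_mul, Complex.exp_add, mul_assoc]
      _ = 𝔼 s, F s * Complex.exp ((x s l * s l : ℝ) * Complex.I) *
            ∏ k ∈ U, (Real.cos (x s k) : ℂ) :=
          ih hFU fun m hm => hx m (mem_insert_of_mem hm)
      _ = 𝔼 s, F s * ∏ k ∈ insert l U, (Real.cos (x s k) : ℂ) := by
          refine expect_eq_expect_of_add_flipSigns (T := {l}) fun s => ?_
          rw [hF l (mem_insert_self l U), hx l (mem_insert_self l U),
            flipSigns_apply_of_mem (mem_singleton_self l), prod_insert hl]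
          linear_combination F s * (∏ k ∈ U, (Real.cos (x s k) : ℂ)) *
            exp_sign_mul_I_add_exp_neg (x s l) (s l)

end SignAverage

section Circuit

variable {n : ℕ} {G : SimpleGraph (Fin n)} {θ : Fin n → Fin n → ℝ}

theorem gate_mulVec_signVec (θ : ℝ) (i j : Fin n) (s : Fin n → ℤˣ) :
    gate θ i j *ᵥ signVec s =
      Complex.exp ((θ * (s i * s j) / 2 : ℝ) * Complex.I) • signVec s := by
  refine exp_mulVec ?_
  rw [smul_mulVec, ← mulVec_mulVec, xMinusY_mulVec_signVec, mulVec_smul, xMinusY_mulVec_signVec,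
    smul_smul, smul_smul]
  congr 1
  push_cast
  linear_combination (Complex.I * θ / 4 * (s i * s j) : ℂ) * ofReal_sqrt_two_mul_self

/-- The phase acquired by the joint eigenvector `signVec s` under the circuit. -/
def phase (G : SimpleGraph (Fin n)) (θ : Fin n → Fin n → ℝ) (s : Fin n → ℤˣ) : ℝ :=
  ∑ e ∈ edges G, θ e.1 e.2 * (s e.1 * s e.2) / 2

theorem circuit_mulVec_signVec (G : SimpleGraph (Fin n)) (θ : Fin n → Fin n → ℝ)
    (s : Fin n → ℤˣ) :
    circuit G θ *ᵥ signVec s = Complex.exp (phase G θ s * Complex.I) • signVec s := by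
  suffices h : ∀ (S : Finset (Fin n × Fin n))
      (hS : (S : Set (Fin n × Fin n)).Pairwise
        (Function.onFun Commute fun e => gate (θ e.1 e.2) e.1 e.2)),
      S.noncommProd (fun e => gate (θ e.1 e.2) e.1 e.2) hS *ᵥ signVec s =
        Complex.exp ((∑ e ∈ S, θ e.1 e.2 * (s e.1 * s e.2) / 2 : ℝ) * Complex.I) • signVec s from
    h (edges G) _
  intro S hS
  induction S using Finset.induction_on with
  | empty => simp
  | insert e S he ih =>
    rw [noncommProd_insert_of_notMem _ _ _ _ he, ← mulVec_mulVec, ih, mulVec_smul,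
      gate_mulVec_signVec, smul_smul, sum_insert he, Complex.ofReal_add, add_mul, Complex.exp_add,
      mul_comm]

theorem circuit_mulVec_zeroState (G : SimpleGraph (Fin n)) (θ : Fin n → Fin n → ℝ) :
    circuit G θ *ᵥ zeroState n =
      ∑ s, ((((√2 : ℝ) : ℂ) ^ n)⁻¹ * Complex.exp (phase G θ s * Complex.I)) • signVec s := by
  have h : zeroState n = (((√2 : ℝ) : ℂ) ^ n)⁻¹ • ∑ s, signVec s := by
    rw [sum_signVec, inv_smul_smul₀ (by simp)]
  simp only [h, mulVec_smul, mulVec_sum, circuit_mulVec_signVec, smul_sum, smul_smul]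

theorem star_circuit_zeroState_dotProduct_mulVec (G : SimpleGraph (Fin n))
    (θ : Fin n → Fin n → ℝ) {A : Op n} {π : (Fin n → ℤˣ) → Fin n → ℤˣ} {c : (Fin n → ℤˣ) → ℂ}
    (hA : ∀ s, A *ᵥ signVec s = c s • signVec (π s)) :
    star (circuit G θ *ᵥ zeroState n) ⬝ᵥ A *ᵥ circuit G θ *ᵥ zeroState n =
      𝔼 s, c s * Complex.exp ((phase G θ s - phase G θ (π s) : ℝ) * Complex.I) := by
  have hstar : ∀ x : ℝ, star (Complex.exp (x * Complex.I)) = Complex.exp (-x * Complex.I) :=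
    fun x => by
      rw [Complex.star_def, ← Complex.exp_conj, map_mul, Complex.conj_I, Complex.conj_ofReal,
        mul_neg, neg_mul]
  have hcard : ((√2 : ℝ) : ℂ) ^ n * ((√2 : ℝ) : ℂ) ^ n = Fintype.card (Fin n → ℤˣ) := by
    rw [← mul_pow, ofReal_sqrt_two_mul_self]
    simp
  rw [circuit_mulVec_zeroState,
    star_sum_smul_dotProduct_mulVec_sum_smul star_signVec_dotProduct_signVec hA,
    Fintype.expect_eq_sum_div_card, sum_div]
  refine sum_congr rfl fun s _ => ?_
  rw [← hcard, star_mul', star_inv₀, star_pow, Complex.star_def, Complex.conj_ofReal,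
    ← Complex.star_def, hstar, Complex.ofReal_sub, sub_mul, sub_eq_add_neg, Complex.exp_add,
    neg_mul, div_eq_mul_inv, mul_inv]
  ring

theorem star_circuit_zeroState_dotProduct_self (G : SimpleGraph (Fin n))
    (θ : Fin n → Fin n → ℝ) :
    star (circuit G θ *ᵥ zeroState n) ⬝ᵥ circuit G θ *ᵥ zeroState n = 1 := by
  have h := star_circuit_zeroState_dotProduct_mulVec G θ (A := 1) (π := id) (c := 1)
    fun s => by rw [one_mulVec, Pi.one_apply, one_smul, id]
  simpa using h

open Classical in
/-- The interaction matrix of the circuit: `θ`, restricted to the adjacent pairs of `G`. -/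
def angle (G : SimpleGraph (Fin n)) (θ : Fin n → Fin n → ℝ) (k l : Fin n) : ℝ :=
  if G.Adj k l then θ k l else 0

theorem angle_of_adj {k l : Fin n} (h : G.Adj k l) : angle G θ k l = θ k l := if_pos h

theorem angle_comm (hθ : ∀ k l, θ k l = θ l k) (k l : Fin n) : angle G θ k l = angle G θ l k := by
  by_cases h : G.Adj k l
  · rw [angle_of_adj h, angle_of_adj h.symm, hθ]
  · simp [angle, h, G.adj_comm l k]

theorem sum_sum_add_swap {ι : Type*} [Fintype ι] (F : ι → ι → ℝ) :
    ∑ k, ∑ l, (F k l + F l k) = 2 * ∑ k, ∑ l, F k l := by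
  simp only [sum_add_distrib]
  rw [sum_comm (f := fun k l => F l k), two_mul]

theorem two_mul_sum_edges {F : Fin n → Fin n → ℝ} (hF : ∀ k l, F k l = F l k) :
    2 * ∑ e ∈ edges G, F e.1 e.2 = ∑ k, ∑ l, angle G F k l := by
  classical
  rw [edges, sum_filter, Fintype.sum_prod_type, ← sum_sum_add_swap]
  refine sum_congr rfl fun k _ => sum_congr rfl fun l _ => ?_
  rcases lt_trichotomy k l with h | rfl | h
  · simp [angle, h, h.not_gt]
  · simp [angle]
  · simp [angle, h, h.not_gt, G.adj_comm k l, hF k l]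

theorem two_mul_phase (hθ : ∀ k l, θ k l = θ l k) (s : Fin n → ℤˣ) :
    2 * phase G θ s = ∑ k, ∑ l, angle G θ k l * (s k * s l) / 2 := by
  rw [phase, two_mul_sum_edges (F := fun k l => θ k l * (s k * s l) / 2)
    fun k l => by rw [hθ, mul_comm (s k : ℝ)]]
  simp only [angle, ite_mul, ite_div, zero_mul, zero_div]

theorem phase_sub_phase_flipSigns (hθ : ∀ k l, θ k l = θ l k) (T : Finset (Fin n))
    (s : Fin n → ℤˣ) :
    phase G θ s - phase G θ (flipSigns T s) =
      ∑ k ∈ T, ∑ l ∈ Tᶜ, angle G θ k l * (s k * s l) := by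
  have h : 2 * (phase G θ s - phase G θ (flipSigns T s)) =
      2 * ∑ k, ∑ l, if k ∈ T then if l ∈ Tᶜ then angle G θ k l * (s k * s l) else 0 else 0 := by
    rw [mul_sub, two_mul_phase hθ, two_mul_phase hθ, ← sum_sum_add_swap]
    simp only [← sum_sub_distrib]
    refine sum_congr rfl fun k _ => sum_congr rfl fun l _ => ?_
    by_cases hk : k ∈ T <;> by_cases hl : l ∈ T <;>
      simp [flipSigns, hk, hl, angle_comm hθ l k] <;> ring
  rw [mul_left_cancel₀ two_ne_zero h]
  simp only [sum_ite_mem, univ_inter, sum_ite_irrel, sum_const_zero]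

theorem ZZ_mulVec_signVec {i j : Fin n} (hij : i ≠ j) (s : Fin n → ℤˣ) :
    (site .Z i * site .Z j) *ᵥ signVec s = (1 : ℂ) • signVec (flipSigns {i, j} s) := by
  rw [← mulVec_mulVec, Z_mulVec_signVec, Z_mulVec_signVec, one_smul,
    flipSigns_flipSigns (disjoint_singleton.mpr hij), ← insert_eq]

theorem X_add_Y_mul_xMinusY_mulVec_signVec (i j : Fin n) (s : Fin n → ℤˣ) :
    ((site .X i + site .Y i) * xMinusY j) *ᵥ signVec s =
      (-2 * Complex.I * (s i * s j : ℝ)) • signVec (flipSigns {i} s) := by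
  rw [← mulVec_mulVec, xMinusY_mulVec_signVec, mulVec_smul, X_add_Y_mulVec_signVec, smul_smul]
  congr 1
  push_cast
  linear_combination (-Complex.I * s i * s j : ℂ) * ofReal_sqrt_two_mul_self

theorem cos_mul_sign_add_mul_sign (a b : ℝ) (u v : ℤˣ) :
    Real.cos (a * u + b * v) = if u = v then Real.cos (a + b) else Real.cos (a - b) := by
  rcases Int.units_eq_one_or u with rfl | rfl <;> rcases Int.units_eq_one_or v with rfl | rfl
  · simp
  · simp [sub_eq_add_neg]
  · rw [← Real.cos_neg]
    simp [sub_eq_add_neg, add_comm]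
  · rw [← Real.cos_neg]
    simp [add_comm]

theorem star_circuit_zeroState_dotProduct_ZZ (hθ : ∀ k l, θ k l = θ l k) {i j : Fin n}
    (hij : i ≠ j) :
    star (circuit G θ *ᵥ zeroState n) ⬝ᵥ
        (site .Z i * site .Z j) *ᵥ circuit G θ *ᵥ zeroState n =
      ((∏ l ∈ {i, j}ᶜ, Real.cos (angle G θ i l + angle G θ j l) +
        ∏ l ∈ {i, j}ᶜ, Real.cos (angle G θ i l - angle G θ j l)) / 2 : ℝ) := by
  have hphase : ∀ s : Fin n → ℤˣ, phase G θ s - phase G θ (flipSigns {i, j} s) =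
      ∑ l ∈ {i, j}ᶜ, (angle G θ i l * s i + angle G θ j l * s j) * s l := fun s => by
    rw [phase_sub_phase_flipSigns hθ, sum_pair hij, ← sum_add_distrib]
    exact sum_congr rfl fun l _ => by ring
  rw [star_circuit_zeroState_dotProduct_mulVec G θ (ZZ_mulVec_signVec hij)]
  simp only [hphase]
  rw [expect_mul_exp_sum (fun _ _ _ => rfl) fun l hl s => ?_]
  · refine expect_eq_of_add_flipSigns (T := {i}) fun s => ?_
    rw [flipSigns_apply_of_mem (mem_singleton_self i),
      flipSigns_apply_of_notMem (by simpa using hij.symm)]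
    simp only [cos_mul_sign_add_mul_sign]
    rcases Int.units_eq_one_or (s i) with hi | hi <;>
      rcases Int.units_eq_one_or (s j) with hj | hj <;> simp [hi, hj] <;> ring
  · rw [mem_compl, mem_insert, mem_singleton, not_or] at hl
    rw [flipSigns_apply_of_notMem (by simpa using Ne.symm hl.1),
      flipSigns_apply_of_notMem (by simpa using Ne.symm hl.2)]

theorem cos_mul_sign (a : ℝ) (u : ℤˣ) : Real.cos (a * u) = Real.cos a := by
  rcases Int.units_eq_one_or u with rfl | rfl <;> simp

theorem sign_mul_exp_add_neg_sign_mul_exp (a : ℝ) (u v : ℤˣ) :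
    -2 * Complex.I * (u * v : ℝ) * Complex.exp ((a * (u * v) : ℝ) * Complex.I) +
      -2 * Complex.I * ((-u : ℤˣ) * v : ℝ) *
        Complex.exp ((a * ((-u : ℤˣ) * v) : ℝ) * Complex.I) = 4 * Real.sin a := by
  have hsin := Complex.two_sin a
  rw [neg_mul] at hsin
  rcases Int.units_eq_one_or u with rfl | rfl <;> rcases Int.units_eq_one_or v with rfl | rfl <;>
    simp <;> linear_combination -2 * hsin

theorem star_circuit_zeroState_dotProduct_X_add_Y_mul_xMinusY (hθ : ∀ k l, θ k l = θ l k)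
    {i j : Fin n} (hij : i ≠ j) :
    star (circuit G θ *ᵥ zeroState n) ⬝ᵥ
        ((site .X i + site .Y i) * xMinusY j) *ᵥ circuit G θ *ᵥ zeroState n =
      (2 * (Real.sin (angle G θ i j) * ∏ l ∈ {i, j}ᶜ, Real.cos (angle G θ i l)) : ℝ) := by
  have hphase : ∀ s : Fin n → ℤˣ, phase G θ s - phase G θ (flipSigns {i} s) =
      angle G θ i j * (s i * s j) + ∑ l ∈ {i, j}ᶜ, (angle G θ i l * s i) * s l := fun s => by
    have hj : j ∈ ({i}ᶜ : Finset (Fin n)) := by simpa using hij.symm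
    have hcompl : ({i}ᶜ : Finset (Fin n)).erase j = {i, j}ᶜ := by
      ext
      simp [and_comm]
    rw [phase_sub_phase_flipSigns hθ, sum_singleton, ← add_sum_erase _ _ hj, hcompl]
    exact congrArg _ (sum_congr rfl fun l _ => by ring)
  rw [star_circuit_zeroState_dotProduct_mulVec G θ (X_add_Y_mul_xMinusY_mulVec_signVec i j)]
  simp only [hphase, Complex.ofReal_add (_ * _), add_mul (Complex.ofReal _), Complex.exp_add,
    ← mul_assoc (-2 * Complex.I * _)]
  rw [expect_mul_exp_sum (x := fun s l => angle G θ i l * s i) (fun l hl s => ?_) fun l hl s => ?_]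
  · refine expect_eq_of_add_flipSigns (T := {i}) fun s => ?_
    rw [flipSigns_apply_of_mem (mem_singleton_self i),
      flipSigns_apply_of_notMem (by simpa using hij.symm)]
    simp only [cos_mul_sign]
    rw [Complex.ofReal_mul 2, Complex.ofReal_mul (Real.sin _), Complex.ofReal_prod,
      Complex.ofReal_ofNat]
    linear_combination (∏ l ∈ {i, j}ᶜ, (Real.cos (angle G θ i l) : ℂ)) *
      sign_mul_exp_add_neg_sign_mul_exp (angle G θ i j) (s i) (s j)
  · rw [mem_compl, mem_insert, mem_singleton, not_or] at hl
    rw [flipSigns_apply_of_notMem (by simpa using Ne.symm hl.1),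
      flipSigns_apply_of_notMem (by simpa using Ne.symm hl.2)]
  · rw [mem_compl, mem_insert, mem_singleton, not_or] at hl
    rw [flipSigns_apply_of_notMem (by simpa using Ne.symm hl.1)]

end Circuit

section EdgeEnergy

variable {n : ℕ} {G : SimpleGraph (Fin n)} {θ : Fin n → Fin n → ℝ}

theorem edgeHam_eq {i j : Fin n} (hij : i ≠ j) :
    edgeHam i j = (1 / 2 : ℝ) • (1 + (1 / 2 : ℝ) • ((site .X i + site .Y i) * xMinusY j +
      (site .X j + site .Y j) * xMinusY i) + site .Z i * site .Z j) := by
  have hcross : (site .X i + site .Y i) * xMinusY j + (site .X j + site .Y j) * xMinusY i =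
      (2 : ℝ) • (site .X i * site .X j - site .Y i * site .Y j) := by
    have hXX := (site_commute .X .X hij).eq
    have hXY := (site_commute .X .Y hij).eq
    have hYX := (site_commute .Y .X hij).eq
    have hYY := (site_commute .Y .Y hij).eq
    simp only [xMinusY, add_mul, mul_sub, ← hXX, ← hXY, ← hYX, ← hYY, two_smul]
    abel
  rw [hcross, smul_smul, one_div_mul_cancel two_ne_zero, one_smul, edgeHam, site_I, site_I,
    mul_one, add_sub_assoc]

theorem energy_edgeHam_circuit (hθ : ∀ k l, θ k l = θ l k) {i j : Fin n} (hij : i ≠ j) :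
    energy (edgeHam i j) (circuit G θ *ᵥ zeroState n) =
      (1 + (∏ l ∈ {i, j}ᶜ, Real.cos (angle G θ i l) + ∏ l ∈ {i, j}ᶜ, Real.cos (angle G θ j l)) *
        Real.sin (angle G θ i j) +
        (∏ l ∈ {i, j}ᶜ, Real.cos (angle G θ i l + angle G θ j l) +
        ∏ l ∈ {i, j}ᶜ, Real.cos (angle G θ i l - angle G θ j l)) / 2) / 2 := by
  have hone : energy 1 (circuit G θ *ᵥ zeroState n) = 1 := by
    rw [energy, one_mulVec, star_circuit_zeroState_dotProduct_self, Complex.one_re]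
  have hcross : ∀ {k l : Fin n}, k ≠ l →
      energy ((site .X k + site .Y k) * xMinusY l) (circuit G θ *ᵥ zeroState n) =
        2 * (Real.sin (angle G θ k l) * ∏ m ∈ {k, l}ᶜ, Real.cos (angle G θ k m)) := fun hkl => by
    rw [energy, star_circuit_zeroState_dotProduct_X_add_Y_mul_xMinusY hθ hkl, Complex.ofReal_re]
  have hZZ : energy (site .Z i * site .Z j) (circuit G θ *ᵥ zeroState n) =
      (∏ l ∈ {i, j}ᶜ, Real.cos (angle G θ i l + angle G θ j l) +
        ∏ l ∈ {i, j}ᶜ, Real.cos (angle G θ i l - angle G θ j l)) / 2 := by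
    rw [energy, star_circuit_zeroState_dotProduct_ZZ hθ hij, Complex.ofReal_re]
  rw [edgeHam_eq hij, energy_smul, energy_add, energy_add, energy_smul, energy_add, hone,
    hcross hij, hcross hij.symm, hZZ, angle_comm hθ j i, Finset.pair_comm j i]
  ring

theorem two_mul_prod_le_prod_sub_add_prod_add {ι R : Type*} [CommRing R] [LinearOrder R]
    [IsStrictOrderedRing R] {s : Finset ι} {x y : ι → R} (hx : ∀ i ∈ s, 0 ≤ x i)
    (hy : ∀ i ∈ s, 0 ≤ y i) :
    2 * ∏ i ∈ s, x i ≤ ∏ i ∈ s, (x i - y i) + ∏ i ∈ s, (x i + y i) := by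
  classical
  suffices h : 2 * ∏ i ∈ s, x i ≤ ∏ i ∈ s, (x i - y i) + ∏ i ∈ s, (x i + y i) ∧
      ∏ i ∈ s, (x i - y i) ≤ ∏ i ∈ s, (x i + y i) from h.1
  induction s using Finset.induction_on with
  | empty => norm_num
  | insert a s ha ih =>
    rw [forall_mem_insert] at hx hy
    obtain ⟨hsum, hle⟩ := ih hx.2 hy.2
    have hprod : 0 ≤ ∏ i ∈ s, x i := prod_nonneg hx.2
    rw [prod_insert ha, prod_insert ha, prod_insert ha]
    constructor
    · linarith [mul_le_mul_of_nonneg_left hsum hx.1, mul_le_mul_of_nonneg_left hle hy.1]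
    · linarith [mul_le_mul_of_nonneg_left hle hx.1, mul_le_mul_of_nonneg_left hsum hy.1,
        mul_nonneg hy.1 hprod]

theorem le_energy_edgeHam_circuit (hθ : ∀ k l, θ k l = θ l k) {i j : Fin n} (hij : i ≠ j)
    (hc : ∀ k l, 0 ≤ Real.cos (angle G θ k l)) (hs : ∀ k l, 0 ≤ Real.sin (angle G θ k l)) :
    (1 + (∏ l ∈ {i, j}ᶜ, Real.cos (angle G θ i l)) * (∏ l ∈ {i, j}ᶜ, Real.cos (angle G θ j l)) +
      (∏ l ∈ {i, j}ᶜ, Real.cos (angle G θ i l) + ∏ l ∈ {i, j}ᶜ, Real.cos (angle G θ j l)) *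
        Real.sin (angle G θ i j)) / 2 ≤
      energy (edgeHam i j) (circuit G θ *ᵥ zeroState n) := by
  have hprod := two_mul_prod_le_prod_sub_add_prod_add (s := ({i, j} : Finset (Fin n))ᶜ)
    (x := fun l => Real.cos (angle G θ i l) * Real.cos (angle G θ j l))
    (y := fun l => Real.sin (angle G θ i l) * Real.sin (angle G θ j l))
    (fun l _ => mul_nonneg (hc i l) (hc j l)) (fun l _ => mul_nonneg (hs i l) (hs j l))
  simp only [energy_edgeHam_circuit hθ hij, Real.cos_add, Real.cos_sub]
  rw [prod_mul_distrib] at hprod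
  linarith

end EdgeEnergy

/-! ### The approximation ratio -/

section ApproximationRatio

variable {n : ℕ} {G : SimpleGraph (Fin n)} {w : Fin n × Fin n → ℝ}
  {Γ : Matrix (PauliMon n 2) (PauliMon n 2) ℝ} {ν : ℝ → ℝ}

theorem Acoef_eq_prod (i j : Fin n) :
    Acoef ν G Γ i j = ∏ l ∈ {i, j}ᶜ, Real.cos (angle G (fun k l => ν (gval Γ k l)) i l) := by
  classical
  have hfilter : univ.filter (fun k => G.Adj i k ∧ k ≠ j) =
      ({i, j}ᶜ : Finset (Fin n)).filter (G.Adj i) := by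
    ext k
    simp only [mem_filter, mem_univ, true_and, mem_compl, mem_insert, mem_singleton, not_or]
    exact ⟨fun h => ⟨⟨h.1.ne', h.2⟩, h.1⟩, fun h => ⟨h.2, h.1.2⟩⟩
  rw [Acoef, hfilter, prod_filter]
  simp only [angle, apply_ite Real.cos, Real.cos_zero]

theorem lower_le_energy (hw : PosWeight G w) (hc : ∀ x, 0 ≤ Real.cos (ν x))
    (hs : ∀ x, 0 ≤ Real.sin (ν x)) :
    lower ν G w Γ ≤ energy (eprHam G w) (outputState ν G Γ) := by
  rw [lower, eprHam, energy_sum]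
  refine sum_le_sum fun e he => ?_
  rw [energy_smul]
  refine mul_le_mul_of_nonneg_left ?_ (hw e he).le
  have h := le_energy_edgeHam_circuit (G := G) (θ := fun k l => ν (gval Γ k l))
    (fun k l => congrArg ν (gval_comm Γ k l)) (ne_of_mem_edges he)
    (fun k l => by unfold angle; split_ifs <;> simp [hc])
    (fun k l => by unfold angle; split_ifs <;> simp [hs])
  rwa [angle_of_adj (mem_edges.mp he).2, ← Acoef_eq_prod, Finset.pair_comm, ← Acoef_eq_prod] at h

theorem energy_outputState_le_lambdaMax :
    energy (eprHam G w) (outputState ν G Γ) ≤ lambdaMax (eprHam G w) :=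
  energy_le_lambdaMax (isHermitian_eprHam G w) (star_circuit_zeroState_dotProduct_self G _)

theorem lambdaMax_nonneg (hw : PosWeight G w) : 0 ≤ lambdaMax (eprHam G w) :=
  (sum_nonneg fun e he => (hw e he).le).trans (sum_weight_le_lambdaMax G w)

theorem upper_pos (hw : PosWeight G w) (hG : (edges G).Nonempty) (hΓ : IsSDPSolution G w Γ) :
    0 < upper G w Γ :=
  (sum_pos (fun e he => hw e he) hG).trans_le
    ((sum_weight_le_lambdaMax G w).trans hΓ.lambdaMax_le_upper)

theorem lower_nonneg (hw : PosWeight G w) (hc : ∀ x, 0 ≤ Real.cos (ν x))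
    (hs : ∀ x, 0 ≤ Real.sin (ν x)) : 0 ≤ lower ν G w Γ := by
  have hA : ∀ i j, 0 ≤ Acoef ν G Γ i j := fun i j => prod_nonneg fun k _ => hc _
  refine sum_nonneg fun e he => mul_nonneg (hw e he).le (div_nonneg (add_nonneg ?_ ?_) zero_le_two)
  · exact add_nonneg zero_le_one (mul_nonneg (hA _ _) (hA _ _))
  · exact mul_nonneg (add_nonneg (hA _ _) (hA _ _)) (hs _)

theorem lower_div_upper_nonneg (hw : PosWeight G w) (hG : (edges G).Nonempty)
    (hΓ : IsSDPSolution G w Γ) (hc : ∀ x, 0 ≤ Real.cos (ν x)) (hs : ∀ x, 0 ≤ Real.sin (ν x)) :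
    0 ≤ lower ν G w Γ / upper G w Γ :=
  div_nonneg (lower_nonneg hw hc hs) (upper_pos hw hG hΓ).le

theorem ratio_nonneg (hc : ∀ x, 0 ≤ Real.cos (ν x)) (hs : ∀ x, 0 ≤ Real.sin (ν x)) :
    0 ≤ ratio ν := by
  refine Real.sInf_nonneg ?_
  rintro _ ⟨m, G, w, Γ, hw, hG, hΓ, rfl⟩
  exact lower_div_upper_nonneg hw hG hΓ hc hs

theorem ratio_mul_upper_le_lower (hw : PosWeight G w) (hG : (edges G).Nonempty)
    (hΓ : IsSDPSolution G w Γ) (hc : ∀ x, 0 ≤ Real.cos (ν x)) (hs : ∀ x, 0 ≤ Real.sin (ν x)) :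
    ratio ν * upper G w Γ ≤ lower ν G w Γ := by
  rw [← le_div_iff₀ (upper_pos hw hG hΓ)]
  refine csInf_le ⟨0, ?_⟩ ⟨n, G, w, Γ, hw, hG, hΓ, rfl⟩
  rintro _ ⟨m, G', w', Γ', hw', hG', hΓ', rfl⟩
  exact lower_div_upper_nonneg hw' hG' hΓ' hc hs

theorem lambdaMax_eprHam_of_edges_eq_empty (hG : edges G = ∅) : lambdaMax (eprHam G w) = 0 := by
  obtain ⟨ψ, -, h⟩ := exists_energy_eq_lambdaMax (isHermitian_eprHam G w)
  rw [← h]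
  simp [eprHam, hG, energy]

theorem isApproximation_of_le_ratio {a : ℝ} (ha : a ≤ ratio ν) (hc : ∀ x, 0 ≤ Real.cos (ν x))
    (hs : ∀ x, 0 ≤ Real.sin (ν x)) : IsApproximation ν a := by
  refine fun n G w hw => ⟨exists_isSDPSolution G w, fun Γ hΓ =>
    ⟨le_trans ?_ (lower_le_energy hw hc hs), energy_outputState_le_lambdaMax⟩⟩
  obtain hG | hG := (edges G).eq_empty_or_nonempty
  · rw [lambdaMax_eprHam_of_edges_eq_empty hG, mul_zero]
    exact lower_nonneg hw hc hs
  · calc a * lambdaMax (eprHam G w) ≤ ratio ν * lambdaMax (eprHam G w) :=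
          mul_le_mul_of_nonneg_right ha (lambdaMax_nonneg hw)
      _ ≤ ratio ν * upper G w Γ :=
          mul_le_mul_of_nonneg_left hΓ.lambdaMax_le_upper (ratio_nonneg hc hs)
      _ ≤ lower ν G w Γ := ratio_mul_upper_le_lower hw hG hΓ hc hs

theorem minBound_le_ratio {β : ℝ} {Θ Λ : ℝ → ℝ} (hβ : 1 / 2 ≤ β) (hβ' : β ≤ 1)
    (hΘ : ThetaClass Θ) (hΛ : LambdaClass Θ β Λ) :
    minBound β Θ Λ ≤ ratio (nu β Θ Λ) := by
  refine le_csInf ?_ ?_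
  · obtain ⟨Γ, hΓ⟩ := exists_isSDPSolution (⊤ : SimpleGraph (Fin 2)) fun _ => 1
    exact ⟨_, 2, ⊤, fun _ => 1, Γ, fun _ _ => one_pos, ⟨(0, 1), mem_edges.mpr (by simp)⟩, hΓ, rfl⟩
  · rintro _ ⟨n, G, w, Γ, hw, hG, hΓ, rfl⟩
    rw [le_div_iff₀ (upper_pos hw hG hΓ), upper, lower, mul_sum]
    refine sum_le_sum fun e he => ?_
    rw [mul_left_comm]
    refine mul_le_mul_of_nonneg_left ?_ (hw e he).le
    linarith [minBound_mul_le_edge (G := G) hΓ.1 hΘ hΛ hβ hβ' (ne_of_mem_edges he)]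

end ApproximationRatio

end

end EPR

theorem mainTheorem5 (β : ℝ) (hβ : 1 / 2 < β) (hβ' : β ≤ 1)
    (Θ : ℝ → ℝ) (hΘ : EPR.ThetaClass Θ)
    (Λ : ℝ → ℝ) (hΛ : EPR.LambdaClass Θ β Λ) :
    EPR.IsApproximation (EPR.nu β Θ Λ) (EPR.ratio (EPR.nu β Θ Λ)) ∧
    EPR.minBound β Θ Λ ≤ EPR.ratio (EPR.nu β Θ Λ) ∧
    EPR.IsApproximation (EPR.nu β Θ Λ) (EPR.minBound β Θ Λ) := by
  have hratio := EPR.minBound_le_ratio hβ.le hβ' hΘ hΛ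
  have hcos := EPR.cos_nu_nonneg β Θ Λ
  have hsin := EPR.sin_nu_nonneg β Θ Λ
  exact ⟨EPR.isApproximation_of_le_ratio le_rfl hcos hsin, hratio,
    EPR.isApproximation_of_le_ratio hratio hcos hsin⟩
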